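/- Let $\gamma>\frac12$ be a real number with $\gamma\neq\frac{k+1}{2}$ for all $k\in\mathbb N=\{0,1,2,\dots\}$. For $\lambda\in\mathbb C$ consider the equation $$(-s^2\partial_s^2+\gamma(\gamma+1)+is^3)f=\lambda s^2 f,\qquad s\in(0,\infty). \tag{E}$$ For $\delta\in\{-\gamma,\gamma+1\}$ let $g_0=1$, $g_1=0$ and $$g_{n+2}=\frac{-\lambda g_n+i\,g_{n-1}}{(n+2)(n+1+2\delta)}\quad(n\ge 0,\ g_{-1}=0).$$ Then $\sum_{n\ge 0}g_ns^n$ converges for all $\lambda,s\in\mathbb C$; denote its sum by $F_{+,\lambda}(s)$ for $\delta=-\gamma$ and by $F_{-,\lambda}(s)$ for $\delta=\gamma+1$. There are $\lambda_0>0$ and a function $d$, holomorphic in a neighbourhood of the closed disc $\{\lambda\in\mathbb C:|\lambda|\le\lambda_0\}$, such that for every $\lambda$ with $|\lambda|\le\lambda_0$ the function $$H_\lambda(s)=s^{-\gamma}F_{+,\lambda}(s)+d(\lambda)\,s^{\gamma+1}F_{-,\lambda}(s),\qquad s>0,$$ is the $L^2$ solution of (E), that is: 1. $H_\lambda$ is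 a solution of (E) and $\int_1^\infty|H_\lambda(s)|^2\,ds<\infty$; 2. $d(\lambda)$ is the only $c\in\mathbb C$ for which $s^{-\gamma}F_{+,\lambda}+c\,s^{\gamma+1}F_{-,\lambda}$ is square integrable on $(1,\infty)$; 3. every solution of (E) on $(0,\infty)$ that is square integrable on $(1,\infty)$ is a constant multiple of $H_\lambda$. Moreover $d(0)\neq 0$, and $$d(0)=-e^{i\frac{\pi}{2}\frac{2\gamma+1}{3}}\;9^{-\frac{2\gamma+1}{3}}\;\frac{\Gamma\!\left(1-\frac{2\gamma+1}{3}\right)}{\Gamma\!\left(1+\frac{2\gamma+1}{3}\right)}.$$ -/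

import Mathlib

/-- Taylor coefficients `g n` of the regular factor in the Frobenius solution `s ^ δ * g s`:
`g 0 = 1`, `g 1 = 0` and
`g (n + 2) = (-lam * g n + i * g (n - 1)) / ((n + 2) * (n + 1 + 2 * δ))`, with `g (-1) = 0`. -/
noncomputable def modelCoeff (δ : ℝ) (lam : ℂ) : ℕ → ℂ
  | 0 => 1
  | 1 => 0
  | 2 => -lam / (2 * (1 + 2 * (δ : ℂ)))
  | n + 3 => (-lam * modelCoeff δ lam (n + 1) + Complex.I * modelCoeff δ lam n) /
      (((n : ℂ) + 3) * ((n : ℂ) + 2 + 2 * (δ : ℂ)))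

/-- The power series with coefficients `modelCoeff δ lam`. -/
noncomputable def modelSeries (δ : ℝ) (lam s : ℂ) : ℂ :=
  ∑' n : ℕ, modelCoeff δ lam n * s ^ n

/-- `F₊`: the exponent `δ = -γ`. -/
noncomputable def modelFPlus (γ : ℝ) (lam s : ℂ) : ℂ := modelSeries (-γ) lam s

/-- `F₋`: the exponent `δ = γ + 1`. -/
noncomputable def modelFMinus (γ : ℝ) (lam s : ℂ) : ℂ := modelSeries (γ + 1) lam s

/-- `f` is a (classical) solution on `(0, ∞)` of
`(-s² ∂ₛ² + γ (γ + 1) + i s³) f = lam s² f`. -/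
def IsModelSolution (γ : ℝ) (lam : ℂ) (f : ℝ → ℂ) : Prop :=
  ∃ f' f'' : ℝ → ℂ, ∀ s : ℝ, 0 < s →
    HasDerivAt f (f' s) s ∧ HasDerivAt f' (f'' s) s ∧
      -(s : ℂ) ^ 2 * f'' s + ((γ : ℂ) * ((γ : ℂ) + 1) + Complex.I * (s : ℂ) ^ 3) * f s =
        lam * (s : ℂ) ^ 2 * f s

/-- `f` is square integrable on `(1, ∞)`. -/
def IsL2AtInfinity (f : ℝ → ℂ) : Prop :=
  MeasureTheory.MemLp f 2 (MeasureTheory.volume.restrict (Set.Ioi (1 : ℝ)))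

/-- The function `s ^ (-γ) * F₊ s + c * s ^ (γ + 1) * F₋ s` of `s > 0`. -/
noncomputable def modelH (γ : ℝ) (lam c : ℂ) (s : ℝ) : ℂ :=
  ((s ^ (-γ) : ℝ) : ℂ) * modelFPlus γ lam s + c * ((s ^ (γ + 1) : ℝ) : ℂ) * modelFMinus γ lam s

/-! Write (E) as f'' = V f with V = γ(γ+1)/s² + is − λ. For a solution, the flux Q = Re(f̄ f') +
Im(f̄ f') satisfies Q' = |f'|² + (Re V + Im V)|f|², and Re V + Im V ≥ 1/4 when |λ| ≤ 1/4, so Q is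
increasing. This gives a dichotomy: Q > 0 somewhere on [1, ∞) excludes square integrability
(`not_isL2AtInfinity`), while Q ≤ 0 on all of [1, ∞) forces it (`isL2AtInfinity_of_flux_nonpos`).
The Frobenius solution with exponent γ + 1 has Q > 0, so it is not L², and the coefficient of an L²
solution is unique.

Existence is Weyl's construction. Let c_R be the coefficient for which H vanishes at R. Then Q ≤ 0
up to R, which bounds c_R uniformly in λ and R ≥ 1. Limit points of c_R give L² solutions,
uniqueness turns this into convergence, and a bounded pointwise limit of holomorphic functions is
holomorphic.

At λ = 0 put ν = (2γ+1)/3 and w = is³/9. The Frobenius series become Bessel series in w. The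
integral K(w) = ∫ exp(−t − w/t) t^(ν−1) dt is bounded by Γ(ν) on Re w ≥ 0, so s^(−γ) K(w) is
O(s^(−γ)), hence L² because γ > 1/2. The connection formula `macdonald_eq_of_re_nonneg` expresses K
by the two Bessel series, and the ratio of its coefficients is d(0). -/

open Filter Topology MeasureTheory

/-! ### Entire power series depending on a parameter -/

/-- The sequences `a i`, `i ∈ S`, are dominated by every geometric sequence, uniformly in `i`. -/
def EntireFamily {ι : Type*} (S : Set ι) (a : ι → ℕ → ℂ) : Prop :=
  ∀ ρ : ℝ, 0 < ρ → ∃ C : ℝ, ∀ i ∈ S, ∀ n, ‖a i n‖ ≤ C * ρ ^ n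

namespace EntireFamily

variable {ι : Type*} {S : Set ι} {a : ι → ℕ → ℂ}

theorem exists_summable_bound (h : EntireFamily S a) (r : ℝ) :
    ∃ u : ℕ → ℝ, Summable u ∧ ∀ i ∈ S, ∀ s : ℂ, ‖s‖ ≤ r → ∀ n, ‖a i n * s ^ n‖ ≤ u n := by
  obtain ⟨C, hC⟩ := h (1 / (2 * (|r| + 1))) (by positivity)
  refine ⟨fun n => C * (1 / 2) ^ n, (summable_geometric_two).mul_left C, ?_⟩
  intro i hi s hs n
  have h1 := hC i hi n
  have h2 : ‖s‖ ≤ |r| + 1 := by linarith [le_abs_self r]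
  have h3 : ‖s‖ ^ n ≤ (|r| + 1) ^ n := pow_le_pow_left₀ (norm_nonneg s) h2 n
  rw [norm_mul, norm_pow]
  calc ‖a i n‖ * ‖s‖ ^ n ≤ (C * (1 / (2 * (|r| + 1))) ^ n) * (|r| + 1) ^ n := by
        gcongr
        exact (norm_nonneg _).trans h1
    _ = C * (1 / 2) ^ n := by
        rw [mul_assoc, ← mul_pow]
        congr 2
        field_simp

theorem summable (h : EntireFamily S a) {i : ι} (hi : i ∈ S) (s : ℂ) :
    Summable fun n => a i n * s ^ n := by
  obtain ⟨u, hu, hb⟩ := h.exists_summable_bound ‖s‖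
  exact Summable.of_norm_bounded hu fun n => hb i hi s le_rfl n

/-- The factor n + 1 ≤ 2 ^ n is absorbed by using the bound at ρ / 2, so the class is stable under
termwise differentiation. -/
theorem deriv (h : EntireFamily S a) :
    EntireFamily S fun i n => ((n : ℂ) + 1) * a i (n + 1) := by
  intro ρ hρ
  obtain ⟨C, hC⟩ := h (ρ / 2) (by positivity)
  refine ⟨C * (ρ / 2), fun i hi n => ?_⟩
  have h1 := hC i hi (n + 1)
  have h2 : ((n : ℝ) + 1) ≤ 2 ^ n := by exact_mod_cast Nat.lt_two_pow_self (n := n)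
  have h3 : ‖(n : ℂ) + 1‖ = (n : ℝ) + 1 := by
    rw [← Nat.cast_succ, Complex.norm_natCast, Nat.cast_succ]
  rw [norm_mul, h3]
  calc ((n : ℝ) + 1) * ‖a i (n + 1)‖ ≤ 2 ^ n * (C * (ρ / 2) ^ (n + 1)) := by
        gcongr
    _ = C * (ρ / 2) * ρ ^ n := by
        rw [div_pow, pow_succ, pow_succ]
        field_simp

theorem hasDerivAt (h : EntireFamily S a) {i : ι} (hi : i ∈ S) (s : ℂ) :
    HasDerivAt (fun z : ℂ => ∑' n, a i n * z ^ n)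
      (∑' n : ℕ, (((n : ℂ) + 1) * a i (n + 1)) * s ^ n) s := by
  obtain ⟨u, hu, hb⟩ := h.deriv.exists_summable_bound (‖s‖ + 1)
  have hu' : Summable fun n : ℕ => if n = 0 then 0 else u (n - 1) := by
    rw [← summable_nat_add_iff 1]
    simpa using hu
  have key := hasDerivAt_tsum_of_isPreconnected (𝕜 := ℂ)
    (g := fun n z => a i n * z ^ n) (g' := fun n z => a i n * (n * z ^ (n - 1)))
    (t := Metric.ball 0 (‖s‖ + 1)) (y₀ := s) (y := s) hu' Metric.isOpen_ball
    (convex_ball _ _).isPreconnected (fun n z _ => (hasDerivAt_pow n z).const_mul _)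
    (fun n z hz => ?_) (by simp) (h.summable hi s) (by simp)
  · refine key.congr_deriv (Eq.symm ?_)
    have hs : Summable fun n : ℕ => a i n * (n * s ^ (n - 1)) := by
      rw [← summable_nat_add_iff 1]
      refine (h.deriv.summable hi s).congr fun n => ?_
      push_cast
      ring
    have e := hs.tsum_eq_zero_add
    simp only [Nat.cast_zero, zero_mul, mul_zero, zero_add] at e
    refine Eq.trans (tsum_congr fun n => ?_) e.symm
    push_cast
    ring
  · rcases n with _ | n
    · simp
    · have := hb i hi z (by simpa using (mem_ball_zero_iff.mp hz).le) n
      simp only [Nat.add_eq_zero_iff, one_ne_zero, and_false, if_false, Nat.add_sub_cancel]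
      refine le_trans (le_of_eq ?_) this
      push_cast
      congr 1
      ring

theorem hasDerivAt_ofReal (h : EntireFamily S a) {i : ι} (hi : i ∈ S) (s : ℝ) :
    HasDerivAt (fun x : ℝ => ∑' n, a i n * (x : ℂ) ^ n)
      (∑' n : ℕ, (((n : ℂ) + 1) * a i (n + 1)) * (s : ℂ) ^ n) s :=
  (h.hasDerivAt hi s).comp_ofReal

theorem differentiableOn_param {U : Set ℂ} {b : ℂ → ℕ → ℂ} (h : EntireFamily U b)
    (hU : IsOpen U) (hb : ∀ n, DifferentiableOn ℂ (fun z => b z n) U) (s : ℂ) :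
    DifferentiableOn ℂ (fun z => ∑' n, b z n * s ^ n) U := by
  obtain ⟨u, hu, hub⟩ := h.exists_summable_bound ‖s‖
  exact Complex.differentiableOn_tsum_of_summable_norm hu (fun n => (hb n).mul_const _) hU
    fun n z hz => hub z hz s le_rfl n

theorem mono {T : Set ι} (h : EntireFamily S a) (hT : T ⊆ S) : EntireFamily T a := fun ρ hρ =>
  (h ρ hρ).imp fun _ hC i hi => hC i (hT hi)

end EntireFamily

/-! ### Coefficients and series of the Frobenius solutions -/

theorem differentiable_modelCoeff (δ : ℝ) (n : ℕ) :
    Differentiable ℂ fun lam => modelCoeff δ lam n := by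
  induction n using Nat.strong_induction_on with
  | _ n ih =>
    match n with
    | 0 => simp [modelCoeff]
    | 1 => simp [modelCoeff]
    | 2 =>
      simp only [modelCoeff]
      fun_prop
    | n + 3 =>
      simp only [modelCoeff]
      have h1 := ih n (by omega)
      have h2 := ih (n + 1) (by omega)
      fun_prop

/-- The denominators of the recursion tend to infinity, so from some index on it preserves a bound C
ρ ^ n; the earlier coefficients are continuous in λ, hence bounded on the disc. A vanishing
denominator does no harm, division by zero being zero. -/
theorem entireFamily_modelCoeff (δ : ℝ) (L : ℝ) :
    EntireFamily (Metric.closedBall (0 : ℂ) L) (modelCoeff δ) := by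
  intro ρ hρ
  have hbd : ∀ n, ∃ c : ℝ, ∀ lam ∈ Metric.closedBall (0 : ℂ) L, ‖modelCoeff δ lam n‖ ≤ c :=
    fun n => (isCompact_closedBall (0 : ℂ) L).exists_bound_of_continuousOn
      (differentiable_modelCoeff δ n).continuous.continuousOn
  choose c hc using hbd
  -- Chosen so that |L| C ρ^(m+1) + C ρ^m = C ρ^(m+3) · M / ρ³.
  set M : ℝ := |L| * ρ + 1 with hM
  have hM0 : 0 < M := by positivity
  set N : ℕ := ⌈M / ρ ^ 3 + 2 * |δ|⌉₊ with hN
  have hbig : ∀ n : ℕ, N ≤ n → M / ρ ^ 3 ≤ ‖((n : ℂ) + 3) * ((n : ℂ) + 2 + 2 * (δ : ℂ))‖ := by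
    intro n hn
    have h1 : M / ρ ^ 3 + 2 * |δ| ≤ n := (Nat.le_ceil _).trans (by exact_mod_cast hn)
    have h2 : 0 ≤ M / ρ ^ 3 := by positivity
    have h3 := neg_abs_le δ
    have h4 := abs_nonneg δ
    have e : ((n : ℂ) + 3) * ((n : ℂ) + 2 + 2 * (δ : ℂ)) =
        (((n + 3) * (n + 2 + 2 * δ) : ℝ) : ℂ) := by push_cast; ring
    rw [e, Complex.norm_real, Real.norm_eq_abs]
    refine le_trans ?_ (le_abs_self _)
    nlinarith
  set C : ℝ := ∑ n ∈ Finset.range (N + 3), |c n| / ρ ^ n with hC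
  have hC0 : 0 ≤ C := Finset.sum_nonneg fun n _ => by positivity
  refine ⟨C, fun lam hlam n => ?_⟩
  have hl : ‖lam‖ ≤ |L| := (mem_closedBall_zero_iff.mp hlam).trans (le_abs_self L)
  induction n using Nat.strong_induction_on with
  | _ n ih =>
    by_cases hn : n < N + 3
    · have h1 : |c n| / ρ ^ n ≤ C :=
        Finset.single_le_sum (f := fun n => |c n| / ρ ^ n) (fun n _ => by positivity)
          (Finset.mem_range.mpr hn)
      rw [div_le_iff₀ (by positivity)] at h1
      exact (hc n lam hlam).trans ((le_abs_self _).trans h1)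
    · obtain ⟨m, rfl⟩ : ∃ m, n = m + 3 := ⟨n - 3, by omega⟩
      have h1 := ih m (by omega)
      have h2 := ih (m + 1) (by omega)
      have h3 := hbig m (by omega)
      have h4 : 0 < M / ρ ^ 3 := by positivity
      simp only [modelCoeff]
      rw [norm_div, div_le_iff₀ (h4.trans_le h3)]
      calc ‖-lam * modelCoeff δ lam (m + 1) + Complex.I * modelCoeff δ lam m‖
          ≤ ‖lam‖ * ‖modelCoeff δ lam (m + 1)‖ + ‖modelCoeff δ lam m‖ := by
            refine (norm_add_le _ _).trans ?_
            simp
        _ ≤ |L| * (C * ρ ^ (m + 1)) + C * ρ ^ m := by gcongr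
        _ = C * ρ ^ (m + 3) * (M / ρ ^ 3) := by
            rw [hM]
            field_simp
            ring
        _ ≤ _ := by gcongr

theorem summable_modelCoeff (δ : ℝ) (lam s : ℂ) :
    Summable fun n => modelCoeff δ lam n * s ^ n :=
  (entireFamily_modelCoeff δ ‖lam‖).summable (by simp) s

/-- The termwise derivative of `modelSeries`. -/
noncomputable def modelSeriesDeriv (δ : ℝ) (lam s : ℂ) : ℂ :=
  ∑' n : ℕ, (((n : ℂ) + 1) * modelCoeff δ lam (n + 1)) * s ^ n

/-- The second termwise derivative of `modelSeries`. -/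
noncomputable def modelSeriesDeriv2 (δ : ℝ) (lam s : ℂ) : ℂ :=
  ∑' n : ℕ, (((n : ℂ) + 1) * ((((n + 1 : ℕ) : ℂ) + 1) * modelCoeff δ lam (n + 1 + 1))) * s ^ n

theorem hasDerivAt_modelSeries (δ : ℝ) (lam : ℂ) (s : ℝ) :
    HasDerivAt (fun x : ℝ => modelSeries δ lam x) (modelSeriesDeriv δ lam s) s :=
  (entireFamily_modelCoeff δ ‖lam‖).hasDerivAt_ofReal (i := lam) (by simp) s

theorem hasDerivAt_modelSeriesDeriv (δ : ℝ) (lam : ℂ) (s : ℝ) :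
    HasDerivAt (fun x : ℝ => modelSeriesDeriv δ lam x) (modelSeriesDeriv2 δ lam s) s :=
  (entireFamily_modelCoeff δ ‖lam‖).deriv.hasDerivAt_ofReal (i := lam) (by simp) s

theorem modelSeries_zero (δ : ℝ) (lam : ℂ) : modelSeries δ lam 0 = 1 := by
  rw [modelSeries, tsum_eq_single 0 (fun n hn => by simp [hn])]
  simp [modelCoeff]

theorem differentiable_modelSeries (δ : ℝ) (s : ℂ) :
    Differentiable ℂ fun lam => modelSeries δ lam s := by
  intro lam
  have h := ((entireFamily_modelCoeff δ (‖lam‖ + 1)).mono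
    Metric.ball_subset_closedBall).differentiableOn_param Metric.isOpen_ball
    (fun n => (differentiable_modelCoeff δ n).differentiableOn) s
  exact h.differentiableAt (Metric.isOpen_ball.mem_nhds (by simp))

theorem differentiable_modelSeriesDeriv (δ : ℝ) (s : ℂ) :
    Differentiable ℂ fun lam => modelSeriesDeriv δ lam s := by
  intro lam
  have h := ((entireFamily_modelCoeff δ (‖lam‖ + 1)).deriv.mono
    Metric.ball_subset_closedBall).differentiableOn_param Metric.isOpen_ball
    (fun n => ((differentiable_modelCoeff δ (n + 1)).const_mul _).differentiableOn) s
  exact h.differentiableAt (Metric.isOpen_ball.mem_nhds (by simp))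

theorem modelCoeff_rec (δ : ℝ) (hδ : ∀ n : ℕ, (n : ℝ) + 1 + 2 * δ ≠ 0) (lam : ℂ) (n : ℕ) :
    ((n : ℂ) + 3) * ((n : ℂ) + 2 + 2 * (δ : ℂ)) * modelCoeff δ lam (n + 3) =
      -lam * modelCoeff δ lam (n + 1) + Complex.I * modelCoeff δ lam n := by
  have h1 : ((n : ℂ) + 2 + 2 * (δ : ℂ)) ≠ 0 := by
    have := hδ (n + 1)
    intro h
    apply this
    have e : (((n + 1 : ℕ) + 1 + 2 * δ : ℝ) : ℂ) = 0 := by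
      rw [← h]; push_cast; ring
    exact_mod_cast e
  have h2 : ((n : ℂ) + 3) ≠ 0 := by exact_mod_cast Nat.succ_ne_zero (n + 2)
  simp only [modelCoeff]
  field_simp

theorem modelSeries_ode (δ : ℝ) (hδ : ∀ n : ℕ, (n : ℝ) + 1 + 2 * δ ≠ 0) (lam s : ℂ) :
    s * modelSeriesDeriv2 δ lam s + 2 * δ * modelSeriesDeriv δ lam s =
      (Complex.I * s ^ 2 - lam * s) * modelSeries δ lam s := by
  have hfam := entireFamily_modelCoeff δ ‖lam‖
  have hl : lam ∈ Metric.closedBall (0 : ℂ) ‖lam‖ := by simp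
  have ha : HasSum _ (modelSeries δ lam s) := (hfam.summable hl s).hasSum
  have hb : HasSum _ (modelSeriesDeriv δ lam s) := (hfam.deriv.summable hl s).hasSum
  have hc : HasSum _ (modelSeriesDeriv2 δ lam s) := (hfam.deriv.deriv.summable hl s).hasSum
  -- The shifts 1, 2, 1 bring every series to the power s ^ (n + 2); the leftover low-order terms
  -- are handled by g₀, g₁, g₂.
  have ha1 := (hasSum_nat_add_iff' 1).mpr ha
  have hb2 := (hasSum_nat_add_iff' 2).mpr hb
  have hc1 := (hasSum_nat_add_iff' 1).mpr hc
  have hL := (hc1.mul_left s).add (hb2.mul_left (2 * (δ : ℂ)))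
  have hR := (ha.mul_left (Complex.I * s ^ 2)).add (ha1.mul_left (-lam * s))
  have h3 : ((1 : ℂ) + 2 * δ) ≠ 0 := by
    have := hδ 0
    simp only [Nat.cast_zero, zero_add] at this
    exact_mod_cast this
  have hg2 : 2 * ((1 : ℂ) + 2 * δ) * modelCoeff δ lam 2 = -lam := by
    simp only [modelCoeff]
    field_simp
  have key := hL.unique (hR.congr_fun ?_)
  · simp [Finset.sum_range_succ, modelCoeff] at key
    simp only [modelCoeff] at hg2
    linear_combination key + s * hg2
  · intro n
    have := modelCoeff_rec δ hδ lam n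
    push_cast
    linear_combination s ^ (n + 2) * this

/-! ### Solution pairs, Frobenius solutions and their Wronskian -/

/-- The potential `V` in the form `f'' = V f` of the model equation. -/
noncomputable def modelPotential (γ : ℝ) (lam : ℂ) (s : ℝ) : ℂ :=
  (γ : ℂ) * ((γ : ℂ) + 1) / (s : ℂ) ^ 2 + Complex.I * s - lam

/-- `f` solves the model equation on `(0, ∞)` and `f'` is its derivative. -/
structure IsSolutionPair (γ : ℝ) (lam : ℂ) (f f' : ℝ → ℂ) : Prop where
  deriv_fst : ∀ s : ℝ, 0 < s → HasDerivAt f (f' s) s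
  deriv_snd : ∀ s : ℝ, 0 < s → HasDerivAt f' (modelPotential γ lam s * f s) s

theorem isModelSolution_iff {γ : ℝ} {lam : ℂ} {f : ℝ → ℂ} :
    IsModelSolution γ lam f ↔ ∃ f', IsSolutionPair γ lam f f' := by
  constructor
  · rintro ⟨f', f'', h⟩
    refine ⟨f', fun s hs => (h s hs).1, fun s hs => ?_⟩
    refine (h s hs).2.1.congr_deriv ?_
    have h1 := (h s hs).2.2
    have hs' : (s : ℂ) ≠ 0 := by exact_mod_cast hs.ne'
    simp only [modelPotential]
    field_simp
    linear_combination -h1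
  · rintro ⟨f', h⟩
    refine ⟨f', fun s => modelPotential γ lam s * f s, fun s hs => ?_⟩
    refine ⟨h.deriv_fst s hs, h.deriv_snd s hs, ?_⟩
    have hs' : (s : ℂ) ≠ 0 := by exact_mod_cast hs.ne'
    have hV : (s : ℂ) ^ 2 * modelPotential γ lam s =
        γ * (γ + 1) + Complex.I * s ^ 3 - lam * s ^ 2 := by
      simp only [modelPotential]
      field_simp
    linear_combination -f s * hV

theorem IsSolutionPair.add_const_mul {γ : ℝ} {lam : ℂ} {f f' g g' : ℝ → ℂ}
    (hf : IsSolutionPair γ lam f f') (hg : IsSolutionPair γ lam g g') (c : ℂ) :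
    IsSolutionPair γ lam (fun s => f s + c * g s) (fun s => f' s + c * g' s) where
  deriv_fst s hs := (hf.deriv_fst s hs).add ((hg.deriv_fst s hs).const_mul c)
  deriv_snd s hs := by
    refine ((hf.deriv_snd s hs).add ((hg.deriv_snd s hs).const_mul c)).congr_deriv ?_
    ring

/-- The Frobenius solution `s ^ δ * F s`. -/
noncomputable def frobSol (δ : ℝ) (lam : ℂ) (s : ℝ) : ℂ :=
  ((s ^ δ : ℝ) : ℂ) * modelSeries δ lam s

/-- The derivative of the Frobenius solution. -/
noncomputable def frobSolDeriv (δ : ℝ) (lam : ℂ) (s : ℝ) : ℂ :=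
  ((δ * s ^ (δ - 1) : ℝ) : ℂ) * modelSeries δ lam s +
    ((s ^ δ : ℝ) : ℂ) * modelSeriesDeriv δ lam s

/-- The hypothesis `hγδ` is the indicial equation: it cancels the s^(δ−2) term, and what remains is
`modelSeries_ode`. -/
theorem isSolutionPair_frobSol {γ δ : ℝ} (hγδ : δ * (δ - 1) = γ * (γ + 1))
    (hδ : ∀ n : ℕ, (n : ℝ) + 1 + 2 * δ ≠ 0) (lam : ℂ) :
    IsSolutionPair γ lam (frobSol δ lam) (frobSolDeriv δ lam) where
  deriv_fst s hs :=
    (Real.hasDerivAt_rpow_const (Or.inl hs.ne')).ofReal_comp.mul (hasDerivAt_modelSeries δ lam s)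
  deriv_snd s hs := by
    have h0 : HasDerivAt (fun x : ℝ => x ^ δ) (δ * s ^ (δ - 1)) s :=
      Real.hasDerivAt_rpow_const (Or.inl hs.ne')
    have h1 : HasDerivAt (fun x : ℝ => δ * x ^ (δ - 1)) (δ * ((δ - 1) * s ^ (δ - 1 - 1))) s :=
      (Real.hasDerivAt_rpow_const (Or.inl hs.ne')).const_mul δ
    have h2 := (h1.ofReal_comp.mul (hasDerivAt_modelSeries δ lam s)).add
      (h0.ofReal_comp.mul (hasDerivAt_modelSeriesDeriv δ lam s))
    refine h2.congr_deriv ?_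
    have hs' : (s : ℂ) ≠ 0 := by exact_mod_cast hs.ne'
    have e1 : s ^ (δ - 1) = s ^ δ / s := Real.rpow_sub_one hs.ne' δ
    have e2 : s ^ (δ - 1 - 1) = s ^ δ / s / s := by
      rw [Real.rpow_sub_one hs.ne', e1]
    have ode := modelSeries_ode δ hδ lam s
    have hc : (δ : ℂ) * (δ - 1) = γ * (γ + 1) := by exact_mod_cast hγδ
    rw [frobSol, modelPotential, e1, e2]
    push_cast
    field_simp
    linear_combination ((s ^ δ : ℝ) : ℂ) * s * ode + ((s ^ δ : ℝ) : ℂ) * modelSeries δ lam s * hc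

theorem modelH_eq (γ : ℝ) (lam c : ℂ) (s : ℝ) :
    modelH γ lam c s = frobSol (-γ) lam s + c * frobSol (γ + 1) lam s := by
  simp only [modelH, frobSol, modelFPlus, modelFMinus]
  ring

/-- The exponents `-γ` and `γ + 1` are non-resonant. -/
theorem nonresonant_neg {γ : ℝ} (hγ' : ∀ k : ℕ, γ ≠ ((k : ℝ) + 1) / 2) (n : ℕ) :
    (n : ℝ) + 1 + 2 * (-γ) ≠ 0 := fun h => hγ' n (by linarith)

theorem nonresonant_add_one {γ : ℝ} (hγ : 1 / 2 < γ) (n : ℕ) :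
    (n : ℝ) + 1 + 2 * (γ + 1) ≠ 0 := by positivity

theorem isSolutionPair_frobSol_neg {γ : ℝ} (hγ' : ∀ k : ℕ, γ ≠ ((k : ℝ) + 1) / 2) (lam : ℂ) :
    IsSolutionPair γ lam (frobSol (-γ) lam) (frobSolDeriv (-γ) lam) :=
  isSolutionPair_frobSol (by ring) (nonresonant_neg hγ') lam

theorem isSolutionPair_frobSol_add_one {γ : ℝ} (hγ : 1 / 2 < γ) (lam : ℂ) :
    IsSolutionPair γ lam (frobSol (γ + 1) lam) (frobSolDeriv (γ + 1) lam) :=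
  isSolutionPair_frobSol (by ring) (nonresonant_add_one hγ) lam

theorem IsSolutionPair.wronskian_const {γ : ℝ} {lam : ℂ} {f f' g g' : ℝ → ℂ}
    (hf : IsSolutionPair γ lam f f') (hg : IsSolutionPair γ lam g g') :
    ∃ W : ℂ, ∀ s : ℝ, 0 < s → f s * g' s - f' s * g s = W := by
  have hd : ∀ s ∈ Set.Ioi (0 : ℝ), HasDerivAt (fun s => f s * g' s - f' s * g s) 0 s := by
    intro s hs
    refine (((hf.deriv_fst s hs).mul (hg.deriv_snd s hs)).sub
      ((hf.deriv_snd s hs).mul (hg.deriv_fst s hs))).congr_deriv ?_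
    ring
  refine ⟨f 1 * g' 1 - f' 1 * g 1, fun s hs => ?_⟩
  exact (convex_Ioi (0 : ℝ)).is_const_of_fderivWithin_eq_zero (𝕜 := ℝ)
    (fun x hx => (hd x hx).differentiableAt.differentiableWithinAt)
    (fun x hx => by
      rw [fderivWithin_of_isOpen isOpen_Ioi hx]
      ext
      simp [(hd x hx).hasFDerivAt.fderiv]) hs (Set.mem_Ioi.mpr one_pos)

theorem wronskian_frobSol {γ : ℝ} (hγ : 1 / 2 < γ) (hγ' : ∀ k : ℕ, γ ≠ ((k : ℝ) + 1) / 2)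
    (lam : ℂ) {s : ℝ} (hs : 0 < s) :
    frobSol (-γ) lam s * frobSolDeriv (γ + 1) lam s -
      frobSolDeriv (-γ) lam s * frobSol (γ + 1) lam s = 2 * γ + 1 := by
  obtain ⟨W, hW⟩ := (isSolutionPair_frobSol_neg hγ' lam).wronskian_const
    (isSolutionPair_frobSol_add_one hγ lam)
  rw [hW s hs]
  -- The Wronskian with its powers of s cancelled: it is continuous at 0, where its value is (γ + 1)
  -- + γ.
  set u : ℝ → ℂ := fun s => modelSeries (-γ) lam s *
    ((γ + 1) * modelSeries (γ + 1) lam s + s * modelSeriesDeriv (γ + 1) lam s) -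
    (-γ * modelSeries (-γ) lam s + s * modelSeriesDeriv (-γ) lam s) *
      modelSeries (γ + 1) lam s with hu
  have hcont : Continuous u := by
    have c1 := fun δ => continuous_iff_continuousAt.mpr
      fun s => (hasDerivAt_modelSeries δ lam s).continuousAt
    have c2 := fun δ => continuous_iff_continuousAt.mpr
      fun s => (hasDerivAt_modelSeriesDeriv δ lam s).continuousAt
    have c1a := c1 (-γ)
    have c1b := c1 (γ + 1)
    have c2a := c2 (-γ)
    have c2b := c2 (γ + 1)
    fun_prop
  have huW : ∀ s : ℝ, 0 < s → u s = W := by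
    intro s hs
    rw [← hW s hs]
    have hs' : (s : ℂ) ≠ 0 := by exact_mod_cast hs.ne'
    have e1 : s ^ (γ + 1) = s ^ γ * s := Real.rpow_add_one hs.ne' γ
    have e2 : s ^ (-γ) = (s ^ γ)⁻¹ := Real.rpow_neg hs.le γ
    have e3 : s ^ (-γ - 1) = (s ^ γ)⁻¹ / s := by rw [Real.rpow_sub_one hs.ne', e2]
    have e4 : γ + 1 - 1 = γ := by ring
    have h5 : ((s ^ γ : ℝ) : ℂ) ≠ 0 := by exact_mod_cast (Real.rpow_pos_of_pos hs γ).ne'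
    simp only [hu, frobSol, frobSolDeriv, e1, e2, e3, e4]
    push_cast
    field_simp
  have h0 : u 0 = 2 * γ + 1 := by
    simp only [hu, Complex.ofReal_zero, modelSeries_zero]
    ring
  rw [← h0]
  have t1 : Filter.Tendsto u (nhdsWithin 0 (Set.Ioi 0)) (nhds (u 0)) :=
    hcont.continuousAt.tendsto.mono_left nhdsWithin_le_nhds
  refine tendsto_nhds_unique (tendsto_const_nhds.congr' ?_) t1
  filter_upwards [self_mem_nhdsWithin] with x hx
  exact (huW x hx).symm

/-- Cramer's rule: the Wronskians of f with the two Frobenius solutions are constant, and theirs is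
2γ + 1 ≠ 0. -/
theorem IsSolutionPair.eq_frobSol_comb {γ : ℝ} (hγ : 1 / 2 < γ)
    (hγ' : ∀ k : ℕ, γ ≠ ((k : ℝ) + 1) / 2) {lam : ℂ} {f f' : ℝ → ℂ}
    (hf : IsSolutionPair γ lam f f') :
    ∃ a b : ℂ, ∀ s : ℝ, 0 < s →
      f s = a * frobSol (-γ) lam s + b * frobSol (γ + 1) lam s := by
  obtain ⟨A, hA⟩ := hf.wronskian_const (isSolutionPair_frobSol_add_one hγ lam)
  obtain ⟨B, hB⟩ := hf.wronskian_const (isSolutionPair_frobSol_neg hγ' lam)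
  have h0 : (2 * (γ : ℂ) + 1) ≠ 0 := by
    have : (2 * γ + 1 : ℝ) ≠ 0 := by positivity
    exact_mod_cast this
  refine ⟨A / (2 * γ + 1), -B / (2 * γ + 1), fun s hs => ?_⟩
  have hW := wronskian_frobSol hγ hγ' lam hs
  rw [div_mul_eq_mul_div, div_mul_eq_mul_div, ← add_div, eq_div_iff h0, ← hW, ← hA s hs, ← hB s hs]
  ring

/-! ### The flux and the dichotomy at infinity -/

/-- The quadratic form `Re (conj z * w) + Im (conj z * w)`. -/
def flux (z w : ℂ) : ℝ := z.re * w.re + z.im * w.im + (z.re * w.im - z.im * w.re)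

theorem flux_ofReal_mul (a b : ℝ) (z w : ℂ) : flux (a * z) (b * w) = a * b * flux z w := by
  simp only [flux, Complex.re_ofReal_mul, Complex.im_ofReal_mul]
  ring

theorem flux_sq_le (z w : ℂ) : flux z w ^ 2 ≤ 2 * (Complex.normSq z * Complex.normSq w) := by
  simp only [flux, Complex.normSq_apply]
  nlinarith [sq_nonneg ((z.re * w.re + z.im * w.im) - (z.re * w.im - z.im * w.re))]

theorem continuous_flux : Continuous fun p : ℂ × ℂ => flux p.1 p.2 := by
  unfold flux
  fun_prop

theorem HasDerivAt.complex_re {f : ℝ → ℂ} {f' : ℂ} {s : ℝ} (h : HasDerivAt f f' s) :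
    HasDerivAt (fun x => (f x).re) f'.re s :=
  Complex.reCLM.hasFDerivAt.comp_hasDerivAt s h

theorem HasDerivAt.complex_im {f : ℝ → ℂ} {f' : ℂ} {s : ℝ} (h : HasDerivAt f f' s) :
    HasDerivAt (fun x => (f x).im) f'.im s :=
  Complex.imCLM.hasFDerivAt.comp_hasDerivAt s h

namespace IsSolutionPair

variable {γ : ℝ} {lam : ℂ} {f f' : ℝ → ℂ}

theorem hasDerivAt_flux (h : IsSolutionPair γ lam f f') {s : ℝ} (hs : 0 < s) :
    HasDerivAt (fun x => flux (f x) (f' x))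
      (Complex.normSq (f' s) +
        (γ * (γ + 1) / s ^ 2 + s - lam.re - lam.im) * Complex.normSq (f s)) s := by
  have h1 := (h.deriv_fst s hs).complex_re
  have h2 := (h.deriv_fst s hs).complex_im
  have h3 := (h.deriv_snd s hs).complex_re
  have h4 := (h.deriv_snd s hs).complex_im
  have hV : modelPotential γ lam s =
      ((γ * (γ + 1) / s ^ 2 : ℝ) : ℂ) + Complex.I * (s : ℂ) - lam := by
    simp only [modelPotential]
    push_cast
    rfl
  have hVre : (modelPotential γ lam s).re = γ * (γ + 1) / s ^ 2 - lam.re := by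
    rw [hV, Complex.sub_re, Complex.add_re, Complex.ofReal_re]
    simp
  have hVim : (modelPotential γ lam s).im = s - lam.im := by
    rw [hV, Complex.sub_im, Complex.add_im, Complex.ofReal_im]
    simp
  rw [Complex.mul_re, hVre, hVim] at h3
  rw [Complex.mul_im, hVre, hVim] at h4
  refine (((h1.mul h3).add (h2.mul h4)).add ((h1.mul h4).sub (h2.mul h3))).congr_deriv ?_
  simp only [Complex.normSq_apply]
  ring

/-- Here γ(γ+1) ≥ 3/4, so γ(γ+1)/s² + s ≥ 3/4 by its second term if s ≥ 3/4 and by its first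
otherwise; Re λ and Im λ cost at most 1/4 each. -/
theorem flux_deriv_ge (hγ : 1 / 2 < γ) (hlam : ‖lam‖ ≤ 1 / 4) {s : ℝ} (hs : 0 < s) (z w : ℂ) :
    Complex.normSq w + 1 / 4 * Complex.normSq z ≤ Complex.normSq w +
        (γ * (γ + 1) / s ^ 2 + s - lam.re - lam.im) * Complex.normSq z := by
  have h1 := (Complex.abs_re_le_norm lam).trans hlam
  have h2 := (Complex.abs_im_le_norm lam).trans hlam
  have h3 := le_abs_self lam.re
  have h4 := le_abs_self lam.im
  have hA : 3 / 4 ≤ γ * (γ + 1) := by nlinarith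
  have h5 : 3 / 4 ≤ γ * (γ + 1) / s ^ 2 + s := by
    rcases le_total (3 / 4) s with h | h
    · have : 0 ≤ γ * (γ + 1) / s ^ 2 := by positivity
      linarith
    · have : 3 / 4 ≤ γ * (γ + 1) / s ^ 2 := by
        rw [le_div_iff₀ (by positivity)]
        nlinarith
      linarith
  have := mul_le_mul_of_nonneg_right
    (show 1 / 4 ≤ γ * (γ + 1) / s ^ 2 + s - lam.re - lam.im by linarith) (Complex.normSq_nonneg z)
  linarith

theorem flux_monotoneOn (h : IsSolutionPair γ lam f f') (hγ : 1 / 2 < γ) (hlam : ‖lam‖ ≤ 1 / 4) :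
    MonotoneOn (fun x => flux (f x) (f' x)) (Set.Ioi 0) := by
  refine monotoneOn_of_deriv_nonneg (convex_Ioi 0)
    (fun x hx => (h.hasDerivAt_flux hx).continuousAt.continuousWithinAt)
    (fun x hx => ?_) (fun x hx => ?_)
  · rw [interior_Ioi] at hx
    exact (h.hasDerivAt_flux hx).differentiableAt.differentiableWithinAt
  · rw [interior_Ioi] at hx
    rw [(h.hasDerivAt_flux hx).deriv]
    have := flux_deriv_ge hγ hlam hx (f x) (f' x)
    have h1 := Complex.normSq_nonneg (f x)
    have h2 := Complex.normSq_nonneg (f' x)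
    linarith

theorem continuousOn (h : IsSolutionPair γ lam f f') : ContinuousOn f (Set.Ioi 0) :=
  fun x hx => (h.deriv_fst x hx).continuousAt.continuousWithinAt

theorem continuousOn_normSq (h : IsSolutionPair γ lam f f') :
    ContinuousOn (fun s => Complex.normSq (f s)) (Set.Ioi 0) :=
  Complex.continuous_normSq.comp_continuousOn h.continuousOn

theorem intervalIntegrable_normSq (h : IsSolutionPair γ lam f f') {a b : ℝ} (ha : 0 < a)
    (hb : 0 < b) :
    IntervalIntegrable (fun s => Complex.normSq (f s)) MeasureTheory.volume a b :=
  (h.continuousOn_normSq.mono fun _ hx => (lt_min ha hb).trans_le hx.1).intervalIntegrable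

theorem hasDerivAt_integral_normSq (h : IsSolutionPair γ lam f f') {a b : ℝ} (ha : 0 < a)
    (hb : 0 < b) :
    HasDerivAt (fun x => ∫ s in a..x, Complex.normSq (f s)) (Complex.normSq (f b)) b :=
  intervalIntegral.integral_hasDerivAt_right (h.intervalIntegrable_normSq ha hb)
    (h.continuousOn_normSq.stronglyMeasurableAtFilter isOpen_Ioi b hb)
    (h.continuousOn_normSq.continuousAt (isOpen_Ioi.mem_nhds hb))

theorem isL2AtInfinity_iff (h : IsSolutionPair γ lam f f') :
    IsL2AtInfinity f ↔
      MeasureTheory.IntegrableOn (fun s => Complex.normSq (f s)) (Set.Ioi 1) := by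
  have hm : MeasureTheory.AEStronglyMeasurable f
      (MeasureTheory.volume.restrict (Set.Ioi (1 : ℝ))) :=
    (h.continuousOn.mono (Set.Ioi_subset_Ioi zero_le_one)).aestronglyMeasurable measurableSet_Ioi
  rw [IsL2AtInfinity, MeasureTheory.memLp_two_iff_integrable_sq_norm hm]
  simp only [Complex.normSq_eq_norm_sq]
  rfl

/-- Since Q² ≤ 2|f|²|f'|² and Q' ≥ |f'|², one has (−2/Q)' = 2Q'/Q² ≥ 1/|f|². With |f|² + 1/|f|² ≥ 2
this makes ∫|f|² − 2/Q − 2x increasing, so ∫|f|² over [s₁, x] is at least 2(x − s₁) − 2/Q(s₁), which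
is unbounded. -/
theorem not_isL2AtInfinity (h : IsSolutionPair γ lam f f') (hγ : 1 / 2 < γ) (hlam : ‖lam‖ ≤ 1 / 4)
    {s₁ : ℝ} (hs₁ : 1 ≤ s₁) (hpos : 0 < flux (f s₁) (f' s₁)) : ¬ IsL2AtInfinity f := by
  rw [h.isL2AtInfinity_iff]
  intro hint
  set Q : ℝ → ℝ := fun s => flux (f s) (f' s) with hQ
  have hQpos : ∀ s, s₁ ≤ s → 0 < Q s := fun s hs => hpos.trans_le
    (h.flux_monotoneOn hγ hlam (Set.mem_Ioi.mpr (by linarith)) (Set.mem_Ioi.mpr (by linarith)) hs)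
  have hd : ∀ s, s₁ ≤ s → HasDerivAt
      (fun x => (∫ t in s₁..x, Complex.normSq (f t)) - 2 * (Q x)⁻¹ - 2 * x) _ s := fun s hs =>
    ((h.hasDerivAt_integral_normSq (by linarith) (by linarith)).sub
      (((h.hasDerivAt_flux (by linarith)).inv (hQpos s hs).ne').const_mul 2)).sub
      ((hasDerivAt_id s).const_mul 2)
  have hmono : MonotoneOn
      (fun x => (∫ t in s₁..x, Complex.normSq (f t)) - 2 * (Q x)⁻¹ - 2 * x) (Set.Ici s₁) := by
    refine monotoneOn_of_deriv_nonneg (convex_Ici s₁)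
      (fun x hx => (hd x hx).continuousAt.continuousWithinAt)
      (fun x hx => ?_) (fun x hx => ?_)
    · rw [interior_Ici] at hx
      exact (hd x (le_of_lt hx)).differentiableAt.differentiableWithinAt
    · rw [interior_Ici] at hx
      rw [(hd x (le_of_lt hx)).deriv]
      have hq := hQpos x (le_of_lt hx)
      have hx0 : 0 < x := by linarith [Set.mem_Ioi.mp hx]
      have h1 := flux_deriv_ge hγ hlam hx0 (f x) (f' x)
      have h2 : Q x ^ 2 ≤ _ := flux_sq_le (f x) (f' x)
      set D := Complex.normSq (f' x) +
        (γ * (γ + 1) / x ^ 2 + x - lam.re - lam.im) * Complex.normSq (f x)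
      have hN := Complex.normSq_nonneg (f x)
      have hP := Complex.normSq_nonneg (f' x)
      change 0 ≤ Complex.normSq (f x) - 2 * (-D / Q x ^ 2) - 2 * 1
      generalize Complex.normSq (f x) = N at *
      generalize Complex.normSq (f' x) = P at *
      have hN0 : 0 < N := by
        rcases hN.eq_or_lt with h0 | h0
        · rw [← h0] at h2
          nlinarith
        · exact h0
      have h3 : N⁻¹ ≤ 2 * (D / Q x ^ 2) := by
        rw [inv_eq_one_div, ← mul_div_assoc, div_le_div_iff₀ hN0 (by positivity)]
        nlinarith
      have h4 : 2 ≤ N + N⁻¹ := by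
        have : N + N⁻¹ - 2 = (N - 1) ^ 2 / N := by
          field_simp
          ring
        have h5 : 0 ≤ (N - 1) ^ 2 / N := by positivity
        linarith
      have h6 : -D / Q x ^ 2 = -(D / Q x ^ 2) := neg_div _ _
      linarith
  set M := ∫ s in Set.Ioi (1 : ℝ), Complex.normSq (f s) with hM
  have hM0 : 0 ≤ M := MeasureTheory.integral_nonneg fun s => Complex.normSq_nonneg _
  have hQ1 : 0 < (Q s₁)⁻¹ := inv_pos.mpr hpos
  set S := s₁ + M + 2 * (Q s₁)⁻¹ + 1 with hS
  have hle : s₁ ≤ S := by linarith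
  have key := hmono (Set.mem_Ici.mpr le_rfl) (Set.mem_Ici.mpr hle) hle
  have h7 : ∫ t in s₁..S, Complex.normSq (f t) ≤ M := by
    rw [intervalIntegral.integral_of_le hle]
    refine MeasureTheory.setIntegral_mono_set hint
      (Filter.Eventually.of_forall fun s => Complex.normSq_nonneg _) ?_
    exact (Set.Ioc_subset_Ioi_self.trans (Set.Ioi_subset_Ioi hs₁)).eventuallyLE
  have h8 : 0 < (Q S)⁻¹ := inv_pos.mpr (hQpos S hle)
  simp only [intervalIntegral.integral_same] at key
  linarith

/-- From Q' ≥ |f|²/4, the integral of |f|² over [1, x] is at most 4(Q(x) − Q(1)) ≤ −4Q(1). -/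
theorem isL2AtInfinity_of_flux_nonpos (h : IsSolutionPair γ lam f f') (hγ : 1 / 2 < γ)
    (hlam : ‖lam‖ ≤ 1 / 4) (hneg : ∀ s, 1 ≤ s → flux (f s) (f' s) ≤ 0) : IsL2AtInfinity f := by
  rw [h.isL2AtInfinity_iff]
  have hd : ∀ s : ℝ, 0 < s → HasDerivAt
      (fun x => flux (f x) (f' x) - 1 / 4 * ∫ t in (1 : ℝ)..x, Complex.normSq (f t)) _ s :=
    fun s hs => (h.hasDerivAt_flux hs).sub
      ((h.hasDerivAt_integral_normSq one_pos hs).const_mul (1 / 4))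
  have hmono : MonotoneOn
      (fun x => flux (f x) (f' x) - 1 / 4 * ∫ t in (1 : ℝ)..x, Complex.normSq (f t))
      (Set.Ioi 0) := by
    refine monotoneOn_of_deriv_nonneg (convex_Ioi 0)
      (fun x hx => (hd x hx).continuousAt.continuousWithinAt)
      (fun x hx => ?_) (fun x hx => ?_)
    · rw [interior_Ioi] at hx
      exact (hd x hx).differentiableAt.differentiableWithinAt
    · rw [interior_Ioi] at hx
      rw [(hd x hx).deriv]
      have := flux_deriv_ge hγ hlam hx (f x) (f' x)
      have h2 := Complex.normSq_nonneg (f' x)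
      linarith
  refine MeasureTheory.integrableOn_Ioi_of_intervalIntegral_norm_bounded
    (-4 * flux (f 1) (f' 1)) 1 (l := Filter.atTop) (b := fun x : ℝ => max 1 x)
    (fun x => ?_) (Filter.tendsto_atTop_mono (le_max_right 1) Filter.tendsto_id)
    (Filter.Eventually.of_forall fun x => ?_)
  · exact ((h.intervalIntegrable_normSq one_pos (by positivity)).1)
  · have hx : (1 : ℝ) ≤ max 1 x := le_max_left _ _
    generalize max 1 x = y at hx
    have key := hmono (Set.mem_Ioi.mpr one_pos) (Set.mem_Ioi.mpr (by linarith)) hx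
    simp only [intervalIntegral.integral_same] at key
    have := hneg y hx
    simp only [Real.norm_of_nonneg (Complex.normSq_nonneg _)]
    linarith

end IsSolutionPair

/-- Near 0 the flux behaves like (γ+1) s^(2γ+1) > 0, and monotonicity carries the sign to every s.
-/
theorem flux_frobSol_pos {γ : ℝ} (hγ : 1 / 2 < γ) {lam : ℂ} (hlam : ‖lam‖ ≤ 1 / 4) {s : ℝ}
    (hs : 0 < s) : 0 < flux (frobSol (γ + 1) lam s) (frobSolDeriv (γ + 1) lam s) := by
  set u : ℝ → ℝ := fun s => flux (modelSeries (γ + 1) lam s)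
    ((γ + 1) * modelSeries (γ + 1) lam s + s * modelSeriesDeriv (γ + 1) lam s) with hu
  have hcont : Continuous u := by
    have c1 := continuous_iff_continuousAt.mpr
      fun s => (hasDerivAt_modelSeries (γ + 1) lam s).continuousAt
    have c2 := continuous_iff_continuousAt.mpr
      fun s => (hasDerivAt_modelSeriesDeriv (γ + 1) lam s).continuousAt
    exact continuous_flux.comp (c1.prodMk (by fun_prop))
  have h0 : 0 < u 0 := by
    simp only [hu, Complex.ofReal_zero, modelSeries_zero, flux]
    simp
    linarith
  have heq : ∀ s : ℝ, 0 < s →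
      flux (frobSol (γ + 1) lam s) (frobSolDeriv (γ + 1) lam s) = s ^ (γ + 1) * s ^ γ * u s := by
    intro s hs
    rw [hu, ← flux_ofReal_mul]
    have e1 : s ^ (γ + 1) = s ^ γ * s := Real.rpow_add_one hs.ne' γ
    have e4 : γ + 1 - 1 = γ := by ring
    congr 1
    rw [frobSolDeriv, e4, e1]
    push_cast
    ring
  have hev : ∀ᶠ x in nhdsWithin (0 : ℝ) (Set.Ioi 0), 0 < u x :=
    (hcont.continuousAt.eventually (lt_mem_nhds h0)).filter_mono nhdsWithin_le_nhds
  have hev2 : ∀ᶠ x in nhdsWithin (0 : ℝ) (Set.Ioi 0), x < s :=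
    (eventually_lt_nhds hs).filter_mono nhdsWithin_le_nhds
  obtain ⟨x, ⟨hx1, hx2⟩, hx3⟩ := ((hev.and hev2).and self_mem_nhdsWithin).exists
  have hx3' : 0 < x := hx3
  refine lt_of_lt_of_le ?_
    ((isSolutionPair_frobSol_add_one hγ lam).flux_monotoneOn hγ hlam hx3 hs hx2.le)
  change 0 < flux (frobSol (γ + 1) lam x) (frobSolDeriv (γ + 1) lam x)
  rw [heq x hx3']
  positivity

theorem frobSol_add_one_ne_zero {γ : ℝ} (hγ : 1 / 2 < γ) {lam : ℂ} (hlam : ‖lam‖ ≤ 1 / 4) {s : ℝ}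
    (hs : 0 < s) : frobSol (γ + 1) lam s ≠ 0 := by
  intro h
  have := flux_frobSol_pos hγ hlam hs
  rw [h] at this
  simp [flux] at this

theorem not_isL2AtInfinity_frobSol {γ : ℝ} (hγ : 1 / 2 < γ) {lam : ℂ} (hlam : ‖lam‖ ≤ 1 / 4) :
    ¬ IsL2AtInfinity (frobSol (γ + 1) lam) :=
  (isSolutionPair_frobSol_add_one hγ lam).not_isL2AtInfinity hγ hlam le_rfl
    (flux_frobSol_pos hγ hlam one_pos)

theorem abs_flux_le (z w : ℂ) : |flux z w| ≤ 2 * (‖z‖ * ‖w‖) := by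
  refine abs_le_of_sq_le_sq ?_ (by positivity)
  refine (flux_sq_le z w).trans ?_
  rw [Complex.normSq_eq_norm_sq, Complex.normSq_eq_norm_sq]
  nlinarith [sq_nonneg (‖z‖ * ‖w‖)]

theorem flux_mul_mul (c z w : ℂ) : flux (c * z) (c * w) = ‖c‖ ^ 2 * flux z w := by
  rw [← Complex.normSq_eq_norm_sq]
  simp only [flux, Complex.mul_re, Complex.mul_im, Complex.normSq_apply]
  ring

theorem flux_add_add (z z' w w' : ℂ) :
    flux (z + z') (w + w') = flux z w + flux z w' + flux z' w + flux z' w' := by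
  simp only [flux, Complex.add_re, Complex.add_im]
  ring

/-- If the flux of `z + c z'` is nonpositive and that of `z'` positive then `c` is bounded. -/
theorem norm_le_of_flux_nonpos {z z' w w' c : ℂ} (h' : 0 < flux z' w')
    (h : flux (z + c * z') (w + c * w') ≤ 0) :
    ‖c‖ ≤ 1 + 2 * (‖z‖ * ‖w‖ + ‖z‖ * ‖w'‖ + ‖z'‖ * ‖w‖) / flux z' w' := by
  rw [flux_add_add, flux_mul_mul] at h
  have h1 := (abs_le.mp (abs_flux_le z w)).1
  have h2 := (abs_le.mp (abs_flux_le z (c * w'))).1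
  have h3 := (abs_le.mp (abs_flux_le (c * z') w)).1
  rw [norm_mul] at h2 h3
  have hzw : 0 ≤ ‖z‖ * ‖w‖ := by positivity
  have hpos : 0 ≤ 2 * (‖z‖ * ‖w‖ + ‖z‖ * ‖w'‖ + ‖z'‖ * ‖w‖) / flux z' w' := by positivity
  by_cases hc : ‖c‖ ≤ 1
  · linarith
  · push Not at hc
    have : ‖c‖ ≤ 2 * (‖z‖ * ‖w‖ + ‖z‖ * ‖w'‖ + ‖z'‖ * ‖w‖) / flux z' w' := by
      rw [le_div_iff₀ h']
      -- The flux term is quadratic in c and the others at most linear; for ‖c‖ > 1 a factor ‖c‖ can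
      -- also be inserted in the constant one and then cancelled.
      have h4 : ‖c‖ * (‖c‖ * flux z' w') ≤
          ‖c‖ * (2 * (‖z‖ * ‖w‖ + ‖z‖ * ‖w'‖ + ‖z'‖ * ‖w‖)) := by nlinarith
      exact le_of_mul_le_mul_left h4 (by linarith)
    linarith

theorem differentiable_frobSol (δ : ℝ) (s : ℝ) : Differentiable ℂ fun lam => frobSol δ lam s :=
  (differentiable_modelSeries δ s).const_mul _

theorem differentiable_frobSolDeriv (δ : ℝ) (s : ℝ) :
    Differentiable ℂ fun lam => frobSolDeriv δ lam s :=
  ((differentiable_modelSeries δ s).const_mul _).add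
    ((differentiable_modelSeriesDeriv δ s).const_mul _)

/-- The derivative of `modelH`. -/
noncomputable def modelHDeriv (γ : ℝ) (lam c : ℂ) (s : ℝ) : ℂ :=
  frobSolDeriv (-γ) lam s + c * frobSolDeriv (γ + 1) lam s

theorem isSolutionPair_modelH {γ : ℝ} (hγ : 1 / 2 < γ) (hγ' : ∀ k : ℕ, γ ≠ ((k : ℝ) + 1) / 2)
    (lam c : ℂ) : IsSolutionPair γ lam (modelH γ lam c) (modelHDeriv γ lam c) := by
  have h := (isSolutionPair_frobSol_neg hγ' lam).add_const_mul
    (isSolutionPair_frobSol_add_one hγ lam) c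
  rwa [← show modelH γ lam c = fun s => frobSol (-γ) lam s + c * frobSol (γ + 1) lam s from
    funext fun s => modelH_eq γ lam c s] at h

/-- The difference of two such functions is (c − d) times the solution with exponent γ + 1, which is
not L². -/
theorem eq_of_isL2AtInfinity_modelH {γ : ℝ} (hγ : 1 / 2 < γ) {lam : ℂ} (hlam : ‖lam‖ ≤ 1 / 4)
    {c d : ℂ} (hc : IsL2AtInfinity (modelH γ lam c)) (hd : IsL2AtInfinity (modelH γ lam d)) :
    c = d := by
  by_contra hne
  have hcd : c - d ≠ 0 := sub_ne_zero.mpr hne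
  refine not_isL2AtInfinity_frobSol hγ hlam ?_
  have h := (MemLp.sub hc hd).const_mul (c - d)⁻¹
  refine MemLp.congr_norm h ?_ ?_ |>.ae_eq (ae_of_all _ fun s => rfl)
  · have := (isSolutionPair_frobSol_add_one hγ lam).continuousOn.mono
      (Set.Ioi_subset_Ioi zero_le_one)
    exact this.aestronglyMeasurable measurableSet_Ioi
  · refine ae_of_all _ fun s => ?_
    simp only [Pi.sub_apply, modelH_eq]
    congr 1
    field_simp
    ring

/-! ### The Weyl coefficient as a limit, and its holomorphy -/

/-- The coefficient `c` for which `modelH γ lam c` vanishes at `R`. -/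
noncomputable def weylRatio (γ : ℝ) (lam : ℂ) (R : ℝ) : ℂ :=
  -frobSol (-γ) lam R / frobSol (γ + 1) lam R

theorem flux_modelH_weylRatio_nonpos {γ : ℝ} (hγ : 1 / 2 < γ)
    (hγ' : ∀ k : ℕ, γ ≠ ((k : ℝ) + 1) / 2) {lam : ℂ} (hlam : ‖lam‖ ≤ 1 / 4) {s R : ℝ}
    (hs : 0 < s) (hsR : s ≤ R) :
    flux (modelH γ lam (weylRatio γ lam R) s) (modelHDeriv γ lam (weylRatio γ lam R) s) ≤ 0 := by
  have hR : 0 < R := hs.trans_le hsR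
  have h := (isSolutionPair_modelH hγ hγ' lam (weylRatio γ lam R)).flux_monotoneOn hγ hlam
    hs hR hsR
  have h0 : modelH γ lam (weylRatio γ lam R) R = 0 := by
    have := frobSol_add_one_ne_zero hγ hlam hR
    rw [modelH_eq, weylRatio]
    field_simp
    ring
  refine h.trans (le_of_eq ?_)
  simp [h0, flux]

/-- The flux inequality at s = 1 bounds the ratio by a function of λ alone, continuous on the
compact disc. -/
theorem exists_bound_weylRatio {γ : ℝ} (hγ : 1 / 2 < γ)
    (hγ' : ∀ k : ℕ, γ ≠ ((k : ℝ) + 1) / 2) :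
    ∃ B : ℝ, ∀ lam : ℂ, ‖lam‖ ≤ 1 / 4 → ∀ R : ℝ, 1 ≤ R → ‖weylRatio γ lam R‖ ≤ B := by
  have c1 := fun δ => (differentiable_frobSol δ 1).continuous
  have c2 := fun δ => (differentiable_frobSolDeriv δ 1).continuous
  have c1a := c1 (-γ)
  have c1b := c1 (γ + 1)
  have c2a := c2 (-γ)
  have c2b := c2 (γ + 1)
  have c3 : Continuous fun lam => flux (frobSol (γ + 1) lam 1) (frobSolDeriv (γ + 1) lam 1) :=
    continuous_flux.comp (c1b.prodMk c2b)
  have hcont : ContinuousOn (fun lam : ℂ => 1 + 2 *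
      (‖frobSol (-γ) lam 1‖ * ‖frobSolDeriv (-γ) lam 1‖ +
        ‖frobSol (-γ) lam 1‖ * ‖frobSolDeriv (γ + 1) lam 1‖ +
        ‖frobSol (γ + 1) lam 1‖ * ‖frobSolDeriv (-γ) lam 1‖) /
      flux (frobSol (γ + 1) lam 1) (frobSolDeriv (γ + 1) lam 1))
      (Metric.closedBall 0 (1 / 4)) := by
    refine ContinuousOn.add continuousOn_const (ContinuousOn.div (by fun_prop) c3.continuousOn ?_)
    intro lam hlam
    exact (flux_frobSol_pos hγ (mem_closedBall_zero_iff.mp hlam) one_pos).ne'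
  obtain ⟨B, hB⟩ := (isCompact_closedBall (0 : ℂ) (1 / 4)).exists_bound_of_continuousOn hcont
  refine ⟨B, fun lam hlam R hR => ?_⟩
  have h1 := flux_modelH_weylRatio_nonpos hγ hγ' hlam one_pos hR
  rw [modelH_eq, modelHDeriv] at h1
  exact (norm_le_of_flux_nonpos (flux_frobSol_pos hγ hlam one_pos) h1).trans
    ((le_abs_self _).trans (hB lam (mem_closedBall_zero_iff.mpr hlam)))

/-- For fixed s the flux is continuous in c and nonpositive along the subsequence as soon as R ≥ s,
so the limit inherits Q ≤ 0 on [1, ∞). -/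
theorem exists_subseq_tendsto_weylRatio {γ : ℝ} (hγ : 1 / 2 < γ)
    (hγ' : ∀ k : ℕ, γ ≠ ((k : ℝ) + 1) / 2) {lam : ℂ} (hlam : ‖lam‖ ≤ 1 / 4) {R : ℕ → ℝ}
    (hR : Tendsto R atTop atTop) :
    ∃ c, IsL2AtInfinity (modelH γ lam c) ∧ ∃ φ : ℕ → ℕ, StrictMono φ ∧
      Tendsto (fun n => weylRatio γ lam (R (φ n))) atTop (𝓝 c) := by
  obtain ⟨B, hB⟩ := exists_bound_weylRatio hγ hγ'
  obtain ⟨c, -, φ, hφ, hlim⟩ := tendsto_subseq_of_frequently_bounded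
    (Metric.isBounded_closedBall (x := (0 : ℂ)) (r := B)) (x := fun n => weylRatio γ lam (R n))
    (Eventually.frequently (by
      filter_upwards [hR.eventually_ge_atTop 1] with n hn
      exact mem_closedBall_zero_iff.mpr (hB lam hlam _ hn)))
  refine ⟨c, ?_, φ, hφ, hlim⟩
  refine (isSolutionPair_modelH hγ hγ' lam c).isL2AtInfinity_of_flux_nonpos hγ hlam
    fun s hs => ?_
  have hc : Continuous fun c => flux (modelH γ lam c s) (modelHDeriv γ lam c s) := by
    simp only [modelH_eq, modelHDeriv]
    exact continuous_flux.comp (by fun_prop : Continuous fun c : ℂ =>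
      (frobSol (-γ) lam s + c * frobSol (γ + 1) lam s,
        frobSolDeriv (-γ) lam s + c * frobSolDeriv (γ + 1) lam s))
  refine le_of_tendsto ((hc.tendsto c).comp hlim) ?_
  filter_upwards [(hR.comp hφ.tendsto_atTop).eventually_ge_atTop s] with n hn
  exact flux_modelH_weylRatio_nonpos hγ hγ' hlam (by linarith) hn

/-- The coefficient `c` for which `modelH γ lam c` is square integrable at infinity. -/
noncomputable def weylCoeff (γ : ℝ) (lam : ℂ) : ℂ :=
  Classical.epsilon fun c => IsL2AtInfinity (modelH γ lam c)

theorem isL2AtInfinity_weylCoeff {γ : ℝ} (hγ : 1 / 2 < γ)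
    (hγ' : ∀ k : ℕ, γ ≠ ((k : ℝ) + 1) / 2) {lam : ℂ} (hlam : ‖lam‖ ≤ 1 / 4) :
    IsL2AtInfinity (modelH γ lam (weylCoeff γ lam)) := by
  obtain ⟨c, hc, -⟩ := exists_subseq_tendsto_weylRatio hγ hγ' hlam
    (tendsto_natCast_atTop_atTop (R := ℝ))
  exact Classical.epsilon_spec (p := fun c => IsL2AtInfinity (modelH γ lam c)) ⟨c, hc⟩

theorem tendsto_weylRatio {γ : ℝ} (hγ : 1 / 2 < γ)
    (hγ' : ∀ k : ℕ, γ ≠ ((k : ℝ) + 1) / 2) {lam : ℂ} (hlam : ‖lam‖ ≤ 1 / 4) :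
    Tendsto (fun n : ℕ => weylRatio γ lam (n + 1)) atTop (𝓝 (weylCoeff γ lam)) := by
  refine tendsto_of_subseq_tendsto fun ns hns => ?_
  obtain ⟨c, hc, φ, -, hφ⟩ := exists_subseq_tendsto_weylRatio hγ hγ' hlam
    (R := fun n => (ns n : ℝ) + 1)
    (tendsto_atTop_add_const_right _ _ (tendsto_natCast_atTop_atTop.comp hns))
  rw [eq_of_isL2AtInfinity_modelH hγ hlam hc (isL2AtInfinity_weylCoeff hγ hγ' hlam)] at hφ
  exact ⟨φ, hφ⟩

/-- A bounded pointwise limit of holomorphic functions is holomorphic. -/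
theorem analyticOnNhd_of_tendsto_of_bounded {f : ℕ → ℂ → ℂ} {g : ℂ → ℂ} {r B : ℝ} (hr : 0 < r)
    (hf : ∀ n, DiffContOnCl ℂ (f n) (Metric.ball 0 r))
    (hB : ∀ n, ∀ z ∈ Metric.closedBall (0 : ℂ) r, ‖f n z‖ ≤ B)
    (hlim : ∀ z ∈ Metric.closedBall (0 : ℂ) r, Tendsto (fun n => f n z) atTop (𝓝 (g z))) :
    AnalyticOnNhd ℂ g (Metric.ball 0 r) := by
  lift r to NNReal using hr.le
  have hmem : ∀ θ, circleMap 0 r θ ∈ Metric.closedBall (0 : ℂ) r :=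
    fun θ => circleMap_mem_closedBall 0 hr.le θ
  have hcirc : ∀ n, Continuous fun θ => f n (circleMap 0 r θ) := by
    intro n
    have h := (hf n).continuousOn
    rw [closure_ball _ hr.ne'] at h
    exact h.comp_continuous (continuous_circleMap 0 r) hmem
  -- Nothing is known of g on the circle beyond being a bounded pointwise limit, but this suffices
  -- for integrability.
  have hmeas : StronglyMeasurable fun θ => g (circleMap 0 r θ) :=
    stronglyMeasurable_of_tendsto atTop (fun n => (hcirc n).stronglyMeasurable)
      (tendsto_pi_nhds.mpr fun θ => hlim _ (hmem θ))
  have hgB : ∀ z ∈ Metric.closedBall (0 : ℂ) r, ‖g z‖ ≤ B := fun z hz =>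
    le_of_tendsto (hlim z hz).norm (Eventually.of_forall fun n => hB n z hz)
  have hint : CircleIntegrable g 0 r := by
    refine (intervalIntegrable_const (c := B)).mono_fun hmeas.aestronglyMeasurable
      (ae_of_all _ fun θ => ?_)
    exact (hgB _ (hmem θ)).trans (le_abs_self B)
  -- The Cauchy integral of g is analytic; it equals g by dominated convergence in Cauchy's formula
  -- for f n.
  have han := (hasFPowerSeriesOn_cauchy_integral hint (NNReal.coe_pos.mp hr)).analyticOnNhd
  rw [Metric.eball_coe] at han
  refine han.congr Metric.isOpen_ball fun z hz => ?_
  have hz' : ∀ θ, circleMap 0 r θ - z ≠ 0 := fun θ =>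
    sub_ne_zero.mpr (circleMap_ne_mem_ball hz θ)
  have h1 : ∀ n, f n z = (2 * Real.pi * Complex.I : ℂ)⁻¹ • ∮ ζ in C(0, r), (ζ - z)⁻¹ • f n ζ :=
    fun n => ((hf n).two_pi_i_inv_smul_circleIntegral_sub_inv_smul hz).symm
  refine tendsto_nhds_unique ?_ (hlim z (Metric.ball_subset_closedBall hz))
  simp_rw [h1]
  refine Tendsto.const_smul ?_ _
  have hc1 : Continuous fun θ => deriv (circleMap 0 r) θ • (circleMap 0 r θ - z)⁻¹ := by
    simp only [deriv_circleMap]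
    have := (continuous_circleMap 0 r)
    exact (this.mul continuous_const).smul
      (((this.sub continuous_const)).inv₀ hz')
  refine intervalIntegral.tendsto_integral_filter_of_dominated_convergence
    (fun θ => ‖deriv (circleMap 0 r) θ • (circleMap 0 r θ - z)⁻¹‖ * B)
    (Eventually.of_forall fun n => ?_) (Eventually.of_forall fun n => ae_of_all _ fun θ _ => ?_)
    ((hc1.norm.mul continuous_const).intervalIntegrable _ _) (ae_of_all _ fun θ _ => ?_)
  · refine Continuous.aestronglyMeasurable ((hc1.smul (hcirc n)).congr fun θ => ?_)
    exact mul_assoc _ _ _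
  · rw [← smul_assoc, norm_smul]
    gcongr
    exact hB n _ (hmem θ)
  · exact ((hlim _ (hmem θ)).const_smul _).const_smul _

theorem analyticOnNhd_weylCoeff {γ : ℝ} (hγ : 1 / 2 < γ)
    (hγ' : ∀ k : ℕ, γ ≠ ((k : ℝ) + 1) / 2) :
    AnalyticOnNhd ℂ (weylCoeff γ) (Metric.ball 0 (1 / 4)) := by
  obtain ⟨B, hB⟩ := exists_bound_weylRatio hγ hγ'
  have h0 : (0 : ℝ) < 1 / 4 := by norm_num
  refine analyticOnNhd_of_tendsto_of_bounded (f := fun n lam => weylRatio γ lam (n + 1)) (B := B)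
    h0 (fun n => ?_) (fun n z hz => hB z (mem_closedBall_zero_iff.mp hz) _ (by simp))
    fun z hz => tendsto_weylRatio hγ hγ' (mem_closedBall_zero_iff.mp hz)
  refine DifferentiableOn.diffContOnCl ?_
  rw [closure_ball _ h0.ne']
  exact (differentiable_frobSol _ _).neg.differentiableOn.div
    (differentiable_frobSol _ _).differentiableOn fun z hz =>
      frobSol_add_one_ne_zero hγ (mem_closedBall_zero_iff.mp hz) (by positivity)

/-! ### The Macdonald integral -/

/-- The integral `∫ t in (0, ∞), exp (-t - w / t) * t ^ (ν - 1)`, a Macdonald function up to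
normalisation. -/
noncomputable def macdonald (ν : ℝ) (w : ℂ) : ℂ :=
  ∫ t in Set.Ioi (0 : ℝ), ((Real.exp (-t) * t ^ (ν - 1) : ℝ) : ℂ) * Complex.exp (-w / t)

theorem norm_exp_neg_div {t : ℝ} (w : ℂ) :
    ‖Complex.exp (-w / t)‖ = Real.exp (-(w.re / t)) := by
  rw [Complex.norm_exp, Complex.div_ofReal_re, Complex.neg_re, neg_div]

theorem norm_exp_neg_div_le_one {t : ℝ} (ht : 0 < t) {w : ℂ} (hw : 0 ≤ w.re) :
    ‖Complex.exp (-w / t)‖ ≤ 1 := by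
  rw [norm_exp_neg_div, Real.exp_le_one_iff]
  have : 0 ≤ w.re / t := by positivity
  linarith

theorem norm_exp_neg_div_le {t a : ℝ} (ht : 0 < t) (ha : 0 < a) {w : ℂ} (hw : a ≤ w.re) (k : ℕ) :
    ‖Complex.exp (-w / t)‖ ≤ k.factorial / a ^ k * t ^ k := by
  have h1 : (a / t) ^ k / k.factorial ≤ Real.exp (a / t) :=
    Real.pow_div_factorial_le_exp _ (by positivity) k
  have h2 : Real.exp (-(w.re / t)) ≤ Real.exp (-(a / t)) := by gcongr
  rw [norm_exp_neg_div]
  refine h2.trans ?_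
  rw [Real.exp_neg, inv_le_comm₀ (Real.exp_pos _) (by positivity)]
  refine le_trans (le_of_eq ?_) h1
  rw [div_pow]
  field_simp

theorem aestronglyMeasurable_macdonald (ν : ℝ) (w : ℂ) :
    AEStronglyMeasurable (fun t : ℝ =>
      ((Real.exp (-t) * t ^ (ν - 1) : ℝ) : ℂ) * Complex.exp (-w / t))
      (volume.restrict (Set.Ioi 0)) := by
  refine Measurable.aestronglyMeasurable ?_
  fun_prop

theorem norm_macdonald_integrand (ν : ℝ) {t : ℝ} (ht : 0 < t) (z : ℂ) :
    ‖((Real.exp (-t) * t ^ (ν - 1) : ℝ) : ℂ) * z‖ = Real.exp (-t) * t ^ (ν - 1) * ‖z‖ := by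
  rw [norm_mul, Complex.norm_real, Real.norm_of_nonneg (by positivity)]

/-- An integrable majorant of the integrand of `macdonald ν w`, uniform in `a ≤ w.re`. -/
theorem exists_bound_macdonald (ν : ℝ) {a : ℝ} (ha : 0 < a) :
    ∃ b : ℝ → ℝ, IntegrableOn b (Set.Ioi 0) ∧ ∀ t, 0 < t → ∀ w : ℂ, a ≤ w.re →
      ‖((Real.exp (-t) * t ^ (ν - 1) : ℝ) : ℂ) * Complex.exp (-w / t)‖ ≤ b t := by
  -- The decay of exp(−w/t) at 0 beats t^(−k), so any real ν is reduced to the convergent integral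
  -- for Γ(ν + k).
  obtain ⟨k, hk⟩ := exists_nat_gt (-ν)
  refine ⟨fun t => k.factorial / a ^ k * (Real.exp (-t) * t ^ (ν + k - 1)),
    (Real.GammaIntegral_convergent (by linarith)).const_mul _, fun t ht w hw => ?_⟩
  rw [norm_macdonald_integrand ν ht]
  have e : t ^ (ν + k - 1) = t ^ (ν - 1) * t ^ k := by
    rw [← Real.rpow_natCast, ← Real.rpow_add ht]
    congr 1
    ring
  calc Real.exp (-t) * t ^ (ν - 1) * ‖Complex.exp (-w / t)‖
      ≤ Real.exp (-t) * t ^ (ν - 1) * (k.factorial / a ^ k * t ^ k) := by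
        gcongr
        exact norm_exp_neg_div_le ht ha hw k
    _ = _ := by
        simp only [e]
        ring

theorem hasDerivAt_macdonald (ν : ℝ) {w : ℂ} (hw : 0 < w.re) :
    HasDerivAt (macdonald ν) (-macdonald (ν - 1) w) w := by
  have ha : 0 < w.re / 2 := by positivity
  obtain ⟨b, hb, hbound⟩ := exists_bound_macdonald ν ha
  obtain ⟨b', hb', hbound'⟩ := exists_bound_macdonald (ν - 1) ha
  have hU : {z : ℂ | w.re / 2 < z.re} ∈ 𝓝 w :=
    (isOpen_lt continuous_const Complex.continuous_re).mem_nhds (by simp; linarith)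
  have key := (hasDerivAt_integral_of_dominated_loc_of_deriv_le (𝕜 := ℂ)
    (μ := volume.restrict (Set.Ioi (0 : ℝ)))
    (F := fun z t => ((Real.exp (-t) * t ^ (ν - 1) : ℝ) : ℂ) * Complex.exp (-z / t))
    (F' := fun z t => -(((Real.exp (-t) * t ^ (ν - 1 - 1) : ℝ) : ℂ) * Complex.exp (-z / t)))
    (bound := b') hU
    (Eventually.of_forall fun z => aestronglyMeasurable_macdonald ν z)
    (hb.mono' (aestronglyMeasurable_macdonald ν w) ?_)
    (aestronglyMeasurable_macdonald (ν - 1) w).neg ?_ hb' ?_).2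
  · rw [integral_neg] at key
    exact key
  · filter_upwards [ae_restrict_mem measurableSet_Ioi] with t ht
    exact hbound t ht w (by linarith)
  · filter_upwards [ae_restrict_mem measurableSet_Ioi] with t ht z hz
    rw [norm_neg]
    exact hbound' t ht z (le_of_lt hz)
  · filter_upwards [ae_restrict_mem measurableSet_Ioi] with t ht z hz
    have ht' : (t : ℂ) ≠ 0 := by exact_mod_cast (ne_of_gt ht)
    have h1 : HasDerivAt (fun z : ℂ => -z / t) (-1 / t) z := (hasDerivAt_neg z).div_const _
    refine (h1.cexp.const_mul _).congr_deriv ?_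
    rw [Real.rpow_sub_one (ne_of_gt ht) (ν - 1)]
    push_cast
    field_simp

theorem continuousOn_macdonald {ν : ℝ} (hν : 0 < ν) :
    ContinuousOn (macdonald ν) {w | 0 ≤ w.re} := by
  refine continuousOn_of_dominated (bound := fun t => Real.exp (-t) * t ^ (ν - 1))
    (fun w _ => aestronglyMeasurable_macdonald ν w) (fun w hw => ?_)
    (Real.GammaIntegral_convergent hν) ?_
  · filter_upwards [ae_restrict_mem measurableSet_Ioi] with t ht
    have ht0 : 0 < t := ht
    rw [norm_macdonald_integrand ν ht]
    exact mul_le_of_le_one_right (by positivity) (norm_exp_neg_div_le_one ht hw)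
  · filter_upwards [ae_restrict_mem measurableSet_Ioi] with t ht
    fun_prop

theorem norm_macdonald_le {ν : ℝ} (hν : 0 < ν) {w : ℂ} (hw : 0 ≤ w.re) :
    ‖macdonald ν w‖ ≤ Real.Gamma ν := by
  rw [Real.Gamma_eq_integral hν]
  refine norm_integral_le_of_norm_le (Real.GammaIntegral_convergent hν) ?_
  filter_upwards [ae_restrict_mem measurableSet_Ioi] with t ht
  have ht0 : 0 < t := ht
  rw [norm_macdonald_integrand ν ht]
  exact mul_le_of_le_one_right (by positivity) (norm_exp_neg_div_le_one ht hw)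

theorem macdonald_zero {ν : ℝ} (hν : 0 < ν) : macdonald ν 0 = Real.Gamma ν := by
  rw [Real.Gamma_eq_integral hν, macdonald, ← integral_complex_ofReal]
  simp

theorem tendsto_macdonald_zero {ν : ℝ} (hν : 0 < ν) :
    Tendsto (fun x : ℝ => macdonald ν x) (𝓝[>] 0) (𝓝 (Real.Gamma ν : ℂ)) := by
  rw [← macdonald_zero hν]
  refine (continuousOn_macdonald hν 0 (by simp)).tendsto.comp
    (tendsto_nhdsWithin_iff.mpr ⟨?_, ?_⟩)
  · exact (Complex.continuous_ofReal.tendsto' 0 0 (by simp)).mono_left nhdsWithin_le_nhds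
  · filter_upwards [self_mem_nhdsWithin] with x hx
    simpa using le_of_lt hx

/-- The substitution t ↦ x / t, made as an inversion followed by a rescaling, swaps the two terms of
the exponent. -/
theorem macdonald_neg (ν : ℝ) {x : ℝ} (hx : 0 < x) :
    macdonald (-ν) x = ((x ^ (-ν) : ℝ) : ℂ) * macdonald ν x := by
  rw [macdonald, ← integral_comp_rpow_Ioi _ (p := -1) (by norm_num)]
  have h2 := integral_comp_mul_left_Ioi' (fun u : ℝ => (|(-1 : ℝ)| * u ^ ((-1 : ℝ) - 1)) •
    (((Real.exp (-u ^ (-1 : ℝ)) * (u ^ (-1 : ℝ)) ^ (-ν - 1) : ℝ) : ℂ) *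
      Complex.exp (-(x : ℂ) / ((u ^ (-1 : ℝ) : ℝ) : ℂ)))) 0 (inv_pos.mpr hx)
  rw [mul_zero] at h2
  rw [← h2, macdonald, ← integral_smul, ← integral_const_mul]
  refine setIntegral_congr_fun measurableSet_Ioi fun t ht => ?_
  have ht0 : 0 < t := ht
  have hx' : (x : ℂ) ≠ 0 := by exact_mod_cast hx.ne'
  have ht' : (t : ℂ) ≠ 0 := by exact_mod_cast ht0.ne'
  have e1 : (x⁻¹ * t) ^ (-1 : ℝ) = x / t := by
    rw [Real.rpow_neg_one]
    field_simp
  have e2 : (x⁻¹ * t) ^ ((-1 : ℝ) - 1) = (x / t) * (x / t) := by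
    rw [Real.rpow_sub_one (by positivity), e1]
    field_simp
  have e3 : (x / t) ^ (-ν - 1) = x ^ (-ν) / x * (t ^ (ν - 1) * t * t) := by
    rw [Real.div_rpow hx.le ht0.le, Real.rpow_sub_one hx.ne', Real.rpow_sub_one ht0.ne',
      Real.rpow_sub_one ht0.ne', Real.rpow_neg ht0.le]
    have := (Real.rpow_pos_of_pos ht0 ν).ne'
    field_simp
  have e4 : -(x : ℂ) / ((x / t : ℝ) : ℂ) = ((-t : ℝ) : ℂ) := by
    push_cast
    field_simp
  have e5 : -(x : ℂ) / (t : ℂ) = ((-(x / t) : ℝ) : ℂ) := by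
    push_cast
    ring
  simp only [e1, e2, e3, e4, e5, ← Complex.ofReal_exp, Complex.real_smul, abs_neg, abs_one, one_mul]
  push_cast
  field_simp

/-! ### Bessel series and the connection formula -/

/-- Taylor coefficients of the entire function `∑ w ^ k / (k! Γ(ν + 1 + k))`. -/
noncomputable def besselCoeff (ν : ℝ) (k : ℕ) : ℂ :=
  (((k.factorial : ℝ)⁻¹ * (Real.Gamma (ν + 1 + k))⁻¹ : ℝ) : ℂ)

/-- The entire function `∑ w ^ k / (k! Γ(ν + 1 + k))`, that is `w ^ (-ν / 2) * I_ν (2 √w)`. -/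
noncomputable def besselSeries (ν : ℝ) (w : ℂ) : ℂ := ∑' k, besselCoeff ν k * w ^ k

theorem entireFamily_besselCoeff : EntireFamily {μ | μ = ν} besselCoeff := by
  intro ρ hρ
  obtain ⟨N, hN⟩ := exists_nat_ge (1 - ν)
  set M : ℝ := 1 + ∑ k ∈ Finset.range N, |(Real.Gamma (ν + 1 + k))⁻¹| with hM
  have hG : ∀ k : ℕ, |(Real.Gamma (ν + 1 + k))⁻¹| ≤ M := by
    intro k
    by_cases hk : k < N
    · have := Finset.single_le_sum (f := fun k : ℕ => |(Real.Gamma (ν + 1 + k))⁻¹|)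
        (fun k _ => abs_nonneg _) (Finset.mem_range.mpr hk)
      linarith
    · have h1 : (2 : ℝ) ≤ ν + 1 + k := by
        have : (N : ℝ) ≤ k := by exact_mod_cast not_lt.mp hk
        linarith
      have h2 : 1 ≤ Real.Gamma (ν + 1 + k) := by
        have := Real.Gamma_strictMonoOn_Ici.monotoneOn (Set.mem_Ici.mpr le_rfl) h1 h1
        rwa [Real.Gamma_two] at this
      have h3 : 0 ≤ ∑ k ∈ Finset.range N, |(Real.Gamma (ν + 1 + k))⁻¹| :=
        Finset.sum_nonneg fun _ _ => abs_nonneg _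
      rw [abs_of_nonneg (by positivity)]
      linarith [inv_le_one_of_one_le₀ h2]
  refine ⟨M * Real.exp ρ⁻¹, ?_⟩
  rintro _ rfl k
  have h1 : ρ⁻¹ ^ k / k.factorial ≤ Real.exp ρ⁻¹ :=
    Real.pow_div_factorial_le_exp _ (by positivity) k
  rw [besselCoeff, Complex.norm_real, Real.norm_eq_abs, abs_mul, abs_of_nonneg (by positivity)]
  have h2 : ((k.factorial : ℝ))⁻¹ = (ρ⁻¹ ^ k / k.factorial) * ρ ^ k := by
    rw [inv_pow]
    field_simp
  calc ((k.factorial : ℝ))⁻¹ * |(Real.Gamma (_ + 1 + k))⁻¹|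
      ≤ ((ρ⁻¹ ^ k / k.factorial) * ρ ^ k) * M := by
        rw [← h2]
        gcongr
        exact hG k
    _ ≤ (Real.exp ρ⁻¹ * ρ ^ k) * M := by
        have : 0 ≤ M := (abs_nonneg _).trans (hG 0)
        gcongr
    _ = _ := by ring

theorem succ_mul_besselCoeff (ν : ℝ) (k : ℕ) :
    ((k : ℂ) + 1) * besselCoeff ν (k + 1) = besselCoeff (ν + 1) k := by
  have h : (k : ℂ) + 1 ≠ 0 := Nat.cast_add_one_ne_zero k
  have e : ν + 1 + ((k + 1 : ℕ) : ℝ) = ν + 1 + 1 + k := by push_cast; ring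
  rw [besselCoeff, besselCoeff, e, Nat.factorial_succ]
  push_cast
  field_simp

theorem hasDerivAt_besselSeries (ν : ℝ) (w : ℂ) :
    HasDerivAt (besselSeries ν) (besselSeries (ν + 1) w) w := by
  have h := (entireFamily_besselCoeff (ν := ν)).hasDerivAt rfl w
  simp only [succ_mul_besselCoeff] at h
  exact h

theorem besselSeries_zero (ν : ℝ) : besselSeries ν 0 = ((Real.Gamma (ν + 1))⁻¹ : ℝ) := by
  rw [besselSeries, tsum_eq_single 0 (fun n hn => by simp [hn])]
  simp [besselCoeff]

theorem besselSeries_sub_one (ν : ℝ) (w : ℂ) :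
    besselSeries (ν - 1) w = ν * besselSeries ν w + w * besselSeries (ν + 1) w := by
  have hs : ∀ μ, HasSum (fun k => besselCoeff μ k * w ^ k) (besselSeries μ w) :=
    fun μ => (entireFamily_besselCoeff.summable rfl w).hasSum
  have h1 := (hasSum_nat_add_iff' 1).mpr (hs (ν - 1))
  have h2 := ((hasSum_nat_add_iff' 1).mpr ((hs ν).mul_left (ν : ℂ))).add ((hs (ν + 1)).mul_left w)
  have hc : ∀ k : ℕ, besselCoeff (ν - 1) k = (ν + k) * besselCoeff ν k := by
    intro k
    have e : ν - 1 + 1 + (k : ℝ) = ν + k := by ring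
    have e2 : ν + 1 + (k : ℝ) = ν + k + 1 := by ring
    rw [besselCoeff, besselCoeff, e, e2]
    by_cases h : ν + k = 0
    -- At a pole `Real.Gamma` is 0, so its inverse is 0 as well and agrees with the entire function
    -- 1/Γ.
    · rw [h, Real.Gamma_zero, show (ν : ℂ) + k = 0 by exact_mod_cast h]
      simp
    · rw [Real.Gamma_add_one h]
      have h' : (ν : ℂ) + k ≠ 0 := by exact_mod_cast h
      push_cast
      rw [mul_inv]
      field_simp
  have key := h1.unique (h2.congr_fun fun k => ?_)
  · have h0 := hc 0
    simp only [Nat.cast_zero, add_zero] at h0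
    simp only [Finset.sum_range_one, pow_zero, mul_one, h0] at key
    linear_combination key
  · have := succ_mul_besselCoeff ν k
    rw [hc (k + 1)]
    push_cast
    linear_combination w ^ (k + 1) * this

theorem hasDerivAt_rpow_mul_besselSeries (ν : ℝ) {x : ℝ} (hx : 0 < x) :
    HasDerivAt (fun x : ℝ => ((x ^ ν : ℝ) : ℂ) * besselSeries ν x)
      (((x ^ (ν - 1) : ℝ) : ℂ) * besselSeries (ν - 1) x) x := by
  refine ((Real.hasDerivAt_rpow_const (p := ν) (Or.inl hx.ne')).ofReal_comp.mul
    (hasDerivAt_besselSeries ν x).comp_ofReal).congr_deriv ?_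
  have hx' : (x : ℂ) ≠ 0 := by exact_mod_cast hx.ne'
  rw [besselSeries_sub_one, Real.rpow_sub_one hx.ne']
  push_cast
  field_simp

/-- The first order system `u' = x ^ (ν - 1) p`, `p' = x ^ (-ν) u` on `(0, ∞)`. -/
def IsBesselPair (ν : ℝ) (u p : ℝ → ℂ) : Prop :=
  ∀ x : ℝ, 0 < x → HasDerivAt u (((x ^ (ν - 1) : ℝ) : ℂ) * p x) x ∧
    HasDerivAt p (((x ^ (-ν) : ℝ) : ℂ) * u x) x

/-- The first-order form serves to evaluate the constant Wronskian at 0, provided both components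
have limits there. -/
theorem IsBesselPair.wronskian_eq {ν : ℝ} {u p v q : ℝ → ℂ} (hu : IsBesselPair ν u p)
    (hv : IsBesselPair ν v q) {u₀ p₀ v₀ q₀ : ℂ} (hu₀ : Tendsto u (𝓝[>] 0) (𝓝 u₀))
    (hp₀ : Tendsto p (𝓝[>] 0) (𝓝 p₀)) (hv₀ : Tendsto v (𝓝[>] 0) (𝓝 v₀))
    (hq₀ : Tendsto q (𝓝[>] 0) (𝓝 q₀)) {x : ℝ} (hx : 0 < x) :
    u x * q x - v x * p x = u₀ * q₀ - v₀ * p₀ := by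
  have hd : ∀ y ∈ Set.Ioi (0 : ℝ), HasDerivAt (fun y => u y * q y - v y * p y) 0 y := by
    intro y hy
    obtain ⟨h1, h2⟩ := hu y hy
    obtain ⟨h3, h4⟩ := hv y hy
    refine ((h1.mul h4).sub (h3.mul h2)).congr_deriv ?_
    ring
  have hconst : ∀ y : ℝ, 0 < y → u y * q y - v y * p y = u x * q x - v x * p x := fun y hy =>
    (convex_Ioi (0 : ℝ)).is_const_of_fderivWithin_eq_zero (𝕜 := ℝ)
      (fun z hz => (hd z hz).differentiableAt.differentiableWithinAt)
      (fun z hz => by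
        rw [fderivWithin_of_isOpen isOpen_Ioi hz]
        ext
        simp [(hd z hz).hasFDerivAt.fderiv]) hy hx
  refine tendsto_nhds_unique (tendsto_const_nhds.congr' ?_) ((hu₀.mul hq₀).sub (hv₀.mul hp₀))
  filter_upwards [self_mem_nhdsWithin] with y hy
  exact (hconst y hy).symm

theorem tendsto_besselSeries_zero (ν : ℝ) :
    Tendsto (fun x : ℝ => besselSeries ν x) (𝓝[>] 0) (𝓝 ((Real.Gamma (ν + 1))⁻¹ : ℝ)) := by
  rw [← besselSeries_zero ν]
  have h := (hasDerivAt_besselSeries ν ((0 : ℝ) : ℂ)).comp_ofReal.continuousAt.tendsto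
  rw [Complex.ofReal_zero] at h
  exact h.mono_left nhdsWithin_le_nhds

theorem tendsto_rpow_mul_besselSeries_zero {ν : ℝ} (hν : 0 < ν) :
    Tendsto (fun x : ℝ => ((x ^ ν : ℝ) : ℂ) * besselSeries ν x) (𝓝[>] 0) (𝓝 0) := by
  have h : Tendsto (fun x : ℝ => ((x ^ ν : ℝ) : ℂ)) (𝓝[>] 0) (𝓝 0) := by
    have h1 : Tendsto (fun x : ℝ => x ^ ν) (𝓝 0) (𝓝 0) := by
      have := (Real.continuousAt_rpow_const 0 ν (Or.inr hν.le)).tendsto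
      rwa [Real.zero_rpow hν.ne'] at this
    exact (Complex.continuous_ofReal.tendsto' 0 0 (by simp)).comp
      (h1.mono_left nhdsWithin_le_nhds)
  simpa using h.mul (tendsto_besselSeries_zero ν)

/-- Cramer's rule for `IsBesselPair`: the Wronskians of K with the two Bessel solutions are both 1,
and theirs is 1/(Γ(ν)Γ(1−ν)). The range 0 < ν < 1 makes all limits at 0 finite. -/
theorem macdonald_eq_of_lt_one {ν : ℝ} (h0 : 0 < ν) (h1 : ν < 1) {x : ℝ} (hx : 0 < x) :
    macdonald ν x = (Real.pi / Real.sin (Real.pi * ν) : ℝ) *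
      (besselSeries (-ν) x - ((x ^ ν : ℝ) : ℂ) * besselSeries ν x) := by
  have hK : IsBesselPair ν (fun x => macdonald ν x) (fun x => -macdonald (1 - ν) x) := by
    intro x hx
    refine ⟨?_, ?_⟩
    · refine (hasDerivAt_macdonald ν (w := x) (by simpa)).comp_ofReal.congr_deriv ?_
      have := macdonald_neg (1 - ν) hx
      rw [neg_sub] at this
      rw [this]
      ring
    · refine (hasDerivAt_macdonald (1 - ν) (w := x) (by simpa)).comp_ofReal.neg.congr_deriv ?_
      rw [← macdonald_neg ν hx, neg_neg]
      congr 1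
      ring
  have hy1 : IsBesselPair ν (fun x => besselSeries (-ν) x)
      (fun x => ((x ^ (1 - ν) : ℝ) : ℂ) * besselSeries (1 - ν) x) := by
    intro x hx
    refine ⟨?_, ?_⟩
    · refine (hasDerivAt_besselSeries (-ν) x).comp_ofReal.congr_deriv ?_
      rw [← mul_assoc, ← Complex.ofReal_mul, ← Real.rpow_add hx]
      simp [neg_add_eq_sub]
    · refine (hasDerivAt_rpow_mul_besselSeries (1 - ν) hx).congr_deriv ?_
      simp
  have hy2 : IsBesselPair ν (fun x => ((x ^ ν : ℝ) : ℂ) * besselSeries ν x)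
      (fun x => besselSeries (ν - 1) x) := by
    intro x hx
    refine ⟨hasDerivAt_rpow_mul_besselSeries ν hx, ?_⟩
    refine (hasDerivAt_besselSeries (ν - 1) x).comp_ofReal.congr_deriv ?_
    rw [← mul_assoc, ← Complex.ofReal_mul, ← Real.rpow_add hx]
    simp
  have h1' : 0 < 1 - ν := by linarith
  have G1 : (Real.Gamma ν : ℂ) ≠ 0 := by exact_mod_cast (Real.Gamma_pos_of_pos h0).ne'
  have G2 : (Real.Gamma (1 - ν) : ℂ) ≠ 0 := by exact_mod_cast (Real.Gamma_pos_of_pos h1').ne'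
  have lK1 := tendsto_macdonald_zero h0
  have lK2 := (tendsto_macdonald_zero h1').neg
  have l11 := tendsto_besselSeries_zero (-ν)
  have l12 := tendsto_rpow_mul_besselSeries_zero h1'
  have l21 := tendsto_rpow_mul_besselSeries_zero h0
  have l22 := tendsto_besselSeries_zero (ν - 1)
  rw [sub_add_cancel] at l22
  rw [neg_add_eq_sub] at l11
  have w1 := hK.wronskian_eq hy2 lK1 lK2 l21 l22 hx
  have w2 := hK.wronskian_eq hy1 lK1 lK2 l11 l12 hx
  have w3 := hy1.wronskian_eq hy2 l11 l12 l21 l22 hx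
  rw [← Real.Gamma_mul_Gamma_one_sub]
  push_cast at *
  rw [mul_inv_cancel₀ G1, zero_mul, sub_zero] at w1
  have G3 := inv_mul_cancel₀ G2
  have w3' : (Real.Gamma ν : ℂ) * Real.Gamma (1 - ν) *
      (besselSeries (-ν) x * besselSeries (ν - 1) x -
        ((x ^ ν : ℝ) : ℂ) * besselSeries ν x *
          (((x ^ (1 - ν) : ℝ) : ℂ) * besselSeries (1 - ν) x)) = 1 := by
    rw [w3]
    field_simp
    simp
  linear_combination -macdonald ν x * w3' + (Real.Gamma ν : ℂ) * Real.Gamma (1 - ν) *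
    (besselSeries (-ν) x * w1 - ((x ^ ν : ℝ) : ℂ) * besselSeries ν x * (w2 + G3))

/-- Reflect to order −ν, differentiate to reach −(ν + 1), reflect back. The sign change matches that
of sin(πν) under ν ↦ ν + 1. -/
theorem macdonald_add_one_eq {ν : ℝ} {C : ℂ} (h : ∀ x : ℝ, 0 < x → macdonald ν x =
      C * (besselSeries (-ν) x - ((x ^ ν : ℝ) : ℂ) * besselSeries ν x)) {x : ℝ} (hx : 0 < x) :
    macdonald (ν + 1) x = -C *
      (besselSeries (-(ν + 1)) x - ((x ^ (ν + 1) : ℝ) : ℂ) * besselSeries (ν + 1) x) := by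
  have h1 : ∀ y : ℝ, 0 < y → macdonald (-ν) y =
      C * (((y ^ (-ν) : ℝ) : ℂ) * besselSeries (-ν) y - besselSeries ν y) := by
    intro y hy
    have e : ((y ^ (-ν) : ℝ) : ℂ) * ((y ^ ν : ℝ) : ℂ) = 1 := by
      rw [← Complex.ofReal_mul, ← Real.rpow_add hy]
      simp
    rw [macdonald_neg ν hy, h y hy]
    linear_combination -C * besselSeries ν y * e
  have d1 : HasDerivAt (fun y : ℝ => macdonald (-ν) y) (-macdonald (-ν - 1) x) x :=
    (hasDerivAt_macdonald (-ν) (w := x) (by simpa)).comp_ofReal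
  have d2 := ((hasDerivAt_rpow_mul_besselSeries (-ν) hx).sub
    (hasDerivAt_besselSeries ν x).comp_ofReal).const_mul C
  have hev : (fun y : ℝ => macdonald (-ν) y) =ᶠ[𝓝 x] fun y : ℝ =>
      C * (((y ^ (-ν) : ℝ) : ℂ) * besselSeries (-ν) y - besselSeries ν y) := by
    filter_upwards [lt_mem_nhds hx] with y hy
    exact h1 y hy
  have key := (d1.congr_of_eventuallyEq hev.symm).unique d2
  have e1 : -ν - 1 = -(ν + 1) := by ring
  rw [e1, macdonald_neg (ν + 1) hx] at key
  have e : ((x ^ (ν + 1) : ℝ) : ℂ) * ((x ^ (-(ν + 1)) : ℝ) : ℂ) = 1 := by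
    rw [← Complex.ofReal_mul, ← Real.rpow_add hx]
    simp
  linear_combination -((x ^ (ν + 1) : ℝ) : ℂ) * key +
    (-C * besselSeries (-(ν + 1)) x - macdonald (ν + 1) x) * e

theorem macdonald_ofReal_eq {ν : ℝ} (hν : 0 < ν) (hint : ∀ n : ℕ, ν ≠ n) {x : ℝ} (hx : 0 < x) :
    macdonald ν x = (Real.pi / Real.sin (Real.pi * ν) : ℝ) *
      (besselSeries (-ν) x - ((x ^ ν : ℝ) : ℂ) * besselSeries ν x) := by
  have key : ∀ (μ : ℝ), 0 < μ → μ < 1 → ∀ (n : ℕ) (x : ℝ), 0 < x →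
      macdonald (μ + n) x = (Real.pi / Real.sin (Real.pi * (μ + n)) : ℝ) *
        (besselSeries (-(μ + n)) x - ((x ^ (μ + n) : ℝ) : ℂ) * besselSeries (μ + n) x) := by
    intro μ h0 h1 n
    induction n with
    | zero =>
      intro x hx
      simpa using macdonald_eq_of_lt_one h0 h1 hx
    | succ n ih =>
      intro x hx
      have h := macdonald_add_one_eq ih hx
      have e : Real.sin (Real.pi * (μ + (n + 1 : ℕ))) = -Real.sin (Real.pi * (μ + n)) := by
        rw [← Real.sin_add_pi]
        congr 1
        push_cast
        ring
      rw [e, Nat.cast_succ, ← add_assoc, h, div_neg, Complex.ofReal_neg]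
  have hfl := Nat.floor_le hν.le
  have hfl' := Nat.lt_floor_add_one ν
  have h := key (ν - ⌊ν⌋₊) ?_ (by linarith) ⌊ν⌋₊ x hx
  · simpa using h
  · exact sub_pos.mpr (lt_of_le_of_ne hfl (hint _).symm)

/-- The identity theorem extends the formula from the positive axis to Re w > 0; continuity of both
sides reaches the imaginary axis, where w = is³/9 lies. -/
theorem macdonald_eq_of_re_nonneg {ν : ℝ} (hν : 0 < ν) (hint : ∀ n : ℕ, ν ≠ n) {w : ℂ}
    (hw : 0 ≤ w.re) (hw0 : w ∈ Complex.slitPlane) :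
    macdonald ν w = (Real.pi / Real.sin (Real.pi * ν) : ℝ) *
      (besselSeries (-ν) w - w ^ (ν : ℂ) * besselSeries ν w) := by
  have hU : IsOpen {z : ℂ | 0 < z.re} := isOpen_lt continuous_const Complex.continuous_re
  have hR : ∀ z ∈ Complex.slitPlane, DifferentiableAt ℂ (fun w : ℂ =>
      (Real.pi / Real.sin (Real.pi * ν) : ℝ) *
        (besselSeries (-ν) w - w ^ (ν : ℂ) * besselSeries ν w)) z := by
    intro z hz
    exact ((hasDerivAt_besselSeries (-ν) z).differentiableAt.sub
      ((differentiableAt_id.cpow_const hz).mul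
        (hasDerivAt_besselSeries ν z).differentiableAt)).const_mul _
  have hEq : Set.EqOn (macdonald ν) (fun w : ℂ => (Real.pi / Real.sin (Real.pi * ν) : ℝ) *
      (besselSeries (-ν) w - w ^ (ν : ℂ) * besselSeries ν w)) {z : ℂ | 0 < z.re} := by
    have ha1 : AnalyticOnNhd ℂ (macdonald ν) {z : ℂ | 0 < z.re} :=
      DifferentiableOn.analyticOnNhd (fun z hz =>
        (hasDerivAt_macdonald ν hz).differentiableAt.differentiableWithinAt) hU
    have ha2 := DifferentiableOn.analyticOnNhd (s := {z : ℂ | 0 < z.re}) (fun z hz =>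
        (hR z (Or.inl hz)).differentiableWithinAt) hU
    refine ha1.eqOn_of_preconnected_of_frequently_eq ha2
      (convex_halfSpace_re_gt 0).isPreconnected (z₀ := ((1 : ℝ) : ℂ)) (by simp) ?_
    have ht : Tendsto (fun x : ℝ => (x : ℂ)) (𝓝[≠] 1) (𝓝[≠] ((1 : ℝ) : ℂ)) :=
      Complex.continuous_ofReal.continuousWithinAt.tendsto_nhdsWithin
        fun x hx => by simpa using hx
    refine ht.frequently (Eventually.frequently ?_)
    filter_upwards [nhdsWithin_le_nhds (lt_mem_nhds (zero_lt_one (α := ℝ)))] with x hx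
    rw [macdonald_ofReal_eq hν hint hx, Complex.ofReal_cpow (le_of_lt hx)]
  have hcl : w ∈ closure {z : ℂ | 0 < z.re} := by
    rw [Complex.closure_setOfPred_lt_re]
    exact hw
  have := mem_closure_iff_nhdsWithin_neBot.mp hcl
  have t1 : Tendsto (macdonald ν) (𝓝[{z : ℂ | 0 < z.re}] w) (𝓝 (macdonald ν w)) :=
    ((continuousOn_macdonald hν) w hw).mono fun z (hz : 0 < z.re) => hz.le
  have t2 := (hR w hw0).continuousAt.tendsto.mono_left
    (nhdsWithin_le_nhds (s := {z : ℂ | 0 < z.re}))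
  refine tendsto_nhds_unique t1 (t2.congr' ?_)
  filter_upwards [self_mem_nhdsWithin] with z hz
  exact (hEq hz).symm

/-! ### The explicit solution at λ = 0 -/

/-- At λ = 0 the recursion jumps by 3, and (3k+3)(3k+2+2δ) = 9(k+1)(ν+1+k) with ν = (2δ−1)/3, which
is the Bessel recursion. -/
theorem modelCoeff_zero_three_mul {δ : ℝ} (hδ : ∀ n : ℕ, (n : ℝ) + 1 + 2 * δ ≠ 0) (k : ℕ) :
    modelCoeff δ 0 (3 * k) = Real.Gamma (1 + (2 * δ - 1) / 3) *
        (besselCoeff ((2 * δ - 1) / 3) k * (Complex.I / 9) ^ k) ∧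
      modelCoeff δ 0 (3 * k + 1) = 0 ∧ modelCoeff δ 0 (3 * k + 2) = 0 := by
  have hne : ∀ k : ℕ, (2 * δ - 1) / 3 + 1 + k ≠ 0 := fun k h => hδ (3 * k + 1) (by
    push_cast
    linarith)
  induction k with
  | zero =>
    refine ⟨?_, by simp [modelCoeff], by simp [modelCoeff]⟩
    have : Real.Gamma (1 + (2 * δ - 1) / 3) ≠ 0 :=
      Real.Gamma_ne_zero fun m h => hne m (by linarith)
    have h' : (Real.Gamma (1 + (2 * δ - 1) / 3) : ℂ) ≠ 0 := by exact_mod_cast this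
    have e : (2 * δ - 1) / 3 + 1 + ((0 : ℕ) : ℝ) = 1 + (2 * δ - 1) / 3 := by
      push_cast
      ring
    rw [besselCoeff, e]
    push_cast
    simp [modelCoeff, h']
  | succ k ih =>
    obtain ⟨h0, h1, h2⟩ := ih
    refine ⟨?_, ?_, ?_⟩
    · change modelCoeff δ 0 (3 * k + 3) = _
      have e : (2 * δ - 1) / 3 + 1 + ((k + 1 : ℕ) : ℝ) = (2 * δ - 1) / 3 + 1 + k + 1 := by
        push_cast
        ring
      have hrec := modelCoeff_rec δ hδ 0 (3 * k)
      have hk : (k : ℂ) + 1 ≠ 0 := Nat.cast_add_one_ne_zero k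
      have hk' : (2 * (δ : ℂ) - 1) / 3 + 1 + k ≠ 0 := by exact_mod_cast hne k
      rw [neg_zero, zero_mul, zero_add, h0] at hrec
      have hmul : ((((3 * k : ℕ) : ℂ) + 3) * (((3 * k : ℕ) : ℂ) + 2 + 2 * δ)) =
          9 * (((k : ℂ) + 1) * ((2 * (δ : ℂ) - 1) / 3 + 1 + k)) := by
        push_cast
        ring
      rw [hmul] at hrec
      have h9 : 9 * (((k : ℂ) + 1) * ((2 * (δ : ℂ) - 1) / 3 + 1 + k)) ≠ 0 := by
        simp [hk, hk']
      refine mul_left_cancel₀ h9 (hrec.trans ?_)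
      rw [besselCoeff, besselCoeff, e, Real.Gamma_add_one (hne k), Nat.factorial_succ, pow_succ]
      push_cast
      rw [mul_inv, mul_inv]
      generalize (2 * (δ : ℂ) - 1) / 3 + 1 + k = D at *
      field_simp
    · change modelCoeff δ 0 (3 * k + 1 + 3) = _
      rw [modelCoeff, h1]
      simp
    · change modelCoeff δ 0 (3 * k + 2 + 3) = _
      rw [modelCoeff, h2]
      simp

theorem modelSeries_zero_eq {δ : ℝ} (hδ : ∀ n : ℕ, (n : ℝ) + 1 + 2 * δ ≠ 0) (s : ℂ) :
    modelSeries δ 0 s = Real.Gamma (1 + (2 * δ - 1) / 3) *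
      besselSeries ((2 * δ - 1) / 3) (s ^ 3 / 9 * Complex.I) := by
  have hinj : Function.Injective fun k : ℕ => 3 * k := fun a b h => by
    simpa using h
  rw [modelSeries, ← hinj.tsum_eq, besselSeries, ← tsum_mul_left]
  · refine tsum_congr fun k => ?_
    rw [(modelCoeff_zero_three_mul hδ k).1, pow_mul, mul_pow, div_pow, div_pow]
    ring
  · intro n hn
    rw [Function.mem_support] at hn
    obtain ⟨h1, h2⟩ := (modelCoeff_zero_three_mul hδ (n / 3)).2
    rcases (by omega : n = 3 * (n / 3) ∨ n = 3 * (n / 3) + 1 ∨ n = 3 * (n / 3) + 2) with h | h | h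
    · exact ⟨n / 3, h.symm⟩
    · rw [h, h1] at hn
      simp at hn
    · rw [h, h2] at hn
      simp at hn

/-- The value at `0` of the Weyl coefficient. -/
noncomputable def weylConst (γ : ℝ) : ℂ :=
  -Complex.exp (Complex.I * ((Real.pi / 2 * ((2 * γ + 1) / 3) : ℝ) : ℂ)) *
    (((9 : ℝ) ^ (-((2 * γ + 1) / 3)) *
      (Real.Gamma (1 - (2 * γ + 1) / 3) / Real.Gamma (1 + (2 * γ + 1) / 3)) : ℝ) : ℂ)

theorem two_mul_add_one_div_three_ne_natCast {γ : ℝ} (hγ : 1 / 2 < γ)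
    (hγ' : ∀ k : ℕ, γ ≠ ((k : ℝ) + 1) / 2) (n : ℕ) : (2 * γ + 1) / 3 ≠ n := by
  intro h
  rcases n with _ | n
  · simp only [Nat.cast_zero] at h
    linarith
  · apply hγ' (3 * n + 1)
    push_cast at *
    linarith

theorem Gamma_one_sub_ne_zero {γ : ℝ} (hγ : 1 / 2 < γ)
    (hγ' : ∀ k : ℕ, γ ≠ ((k : ℝ) + 1) / 2) : Real.Gamma (1 - (2 * γ + 1) / 3) ≠ 0 :=
  Real.Gamma_ne_zero fun m h =>
    two_mul_add_one_div_three_ne_natCast hγ hγ' (m + 1) (by push_cast; linarith)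

theorem weylConst_ne_zero {γ : ℝ} (hγ : 1 / 2 < γ) (hγ' : ∀ k : ℕ, γ ≠ ((k : ℝ) + 1) / 2) :
    weylConst γ ≠ 0 := by
  have h1 := Gamma_one_sub_ne_zero hγ hγ'
  have h2 : Real.Gamma (1 + (2 * γ + 1) / 3) ≠ 0 :=
    (Real.Gamma_pos_of_pos (by linarith)).ne'
  refine mul_ne_zero (neg_ne_zero.mpr (Complex.exp_ne_zero _)) ?_
  rw [Complex.ofReal_ne_zero]
  positivity

theorem mul_I_cpow_ofReal {r : ℝ} (hr : 0 < r) (ν : ℝ) :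
    ((r : ℂ) * Complex.I) ^ (ν : ℂ) =
      ((r ^ ν : ℝ) : ℂ) * Complex.exp (Complex.I * ((Real.pi / 2 * ν : ℝ) : ℂ)) := by
  have hr' : (r : ℂ) ≠ 0 := by exact_mod_cast hr.ne'
  rw [Complex.cpow_def_of_ne_zero (mul_ne_zero hr' Complex.I_ne_zero),
    Complex.log_ofReal_mul hr Complex.I_ne_zero, Complex.log_I, Real.rpow_def_of_pos hr,
    Complex.ofReal_exp, ← Complex.exp_add]
  congr 1
  push_cast
  ring

/-- In the connection formula π/sin(πν) = Γ(ν)Γ(1−ν), so dividing by Γ(ν) normalises the coefficient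
of s^(−γ)F₊ to 1; the factor w^ν supplies s^(2γ+1), 9^(−ν) and the phase exp(iπν/2). -/
theorem modelH_weylConst_eq {γ : ℝ} (hγ : 1 / 2 < γ) (hγ' : ∀ k : ℕ, γ ≠ ((k : ℝ) + 1) / 2)
    {s : ℝ} (hs : 0 < s) :
    modelH γ 0 (weylConst γ) s = ((s ^ (-γ) : ℝ) : ℂ) *
      (((Real.Gamma ((2 * γ + 1) / 3))⁻¹ : ℝ) *
        macdonald ((2 * γ + 1) / 3) (((s ^ 3 / 9 : ℝ) : ℂ) * Complex.I)) := by
  have hr : 0 < s ^ 3 / 9 := by positivity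
  have hν : 0 < (2 * γ + 1) / 3 := by linarith
  have hmac := macdonald_eq_of_re_nonneg hν (two_mul_add_one_div_three_ne_natCast hγ hγ')
    (w := ((s ^ 3 / 9 : ℝ) : ℂ) * Complex.I)
    (by rw [Complex.re_ofReal_mul, Complex.I_re, mul_zero]) (by
      refine Or.inr ?_
      rw [Complex.im_ofReal_mul, Complex.I_im, mul_one]
      exact hr.ne')
  have hG1 := Gamma_one_sub_ne_zero hγ hγ'
  have hG2 := (Real.Gamma_pos_of_pos hν).ne'
  have hG3 : Real.Gamma (1 + (2 * γ + 1) / 3) ≠ 0 :=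
    (Real.Gamma_pos_of_pos (by linarith)).ne'
  rw [hmac, ← Real.Gamma_mul_Gamma_one_sub, mul_I_cpow_ofReal hr, modelH, weylConst, modelFPlus,
    modelFMinus, modelSeries_zero_eq (nonresonant_neg hγ'),
    modelSeries_zero_eq (nonresonant_add_one hγ)]
  have e1 : (2 * -γ - 1) / 3 = -((2 * γ + 1) / 3) := by ring
  have e2 : (2 * (γ + 1) - 1) / 3 = (2 * γ + 1) / 3 := by ring
  have e3 : (s : ℂ) ^ 3 / 9 * Complex.I = ((s ^ 3 / 9 : ℝ) : ℂ) * Complex.I := by push_cast; rfl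
  have e4 : s ^ (γ + 1) = s ^ (-γ) * s ^ (2 * γ + 1) := by
    rw [← Real.rpow_add hs]
    congr 1
    ring
  have e5 : (s ^ 3 / 9) ^ ((2 * γ + 1) / 3) =
      s ^ (2 * γ + 1) * 9 ^ (-((2 * γ + 1) / 3)) := by
    rw [Real.div_rpow (by positivity) (by norm_num), Real.rpow_neg (by norm_num),
      ← Real.rpow_natCast s 3, ← Real.rpow_mul hs.le, div_eq_mul_inv]
    congr 2
    push_cast
    ring
  rw [e1, e2, e3, e4, e5, ← sub_eq_add_neg]
  generalize besselSeries _ _ = B1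
  generalize besselSeries _ _ = B2
  have hG2' : (Real.Gamma ((2 * γ + 1) / 3) : ℂ) ≠ 0 := by exact_mod_cast hG2
  have hG3' : (Real.Gamma (1 + (2 * γ + 1) / 3) : ℂ) ≠ 0 := by exact_mod_cast hG3
  simp only [Complex.ofReal_mul, Complex.ofReal_div, Complex.ofReal_inv]
  generalize (Real.Gamma ((2 * γ + 1) / 3) : ℂ) = G at *
  generalize (Real.Gamma (1 + (2 * γ + 1) / 3) : ℂ) = G' at *
  generalize Complex.exp _ = E
  field_simp
  ring

/-- The bound |K| ≤ Γ(ν) on the imaginary axis gives |H₀(s)| ≤ s^(−γ), and 2γ > 1. -/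
theorem isL2AtInfinity_modelH_weylConst {γ : ℝ} (hγ : 1 / 2 < γ)
    (hγ' : ∀ k : ℕ, γ ≠ ((k : ℝ) + 1) / 2) : IsL2AtInfinity (modelH γ 0 (weylConst γ)) := by
  have hpair := isSolutionPair_modelH hγ hγ' 0 (weylConst γ)
  rw [hpair.isL2AtInfinity_iff]
  have hν : 0 < (2 * γ + 1) / 3 := by linarith
  have hG := Real.Gamma_pos_of_pos hν
  refine Integrable.mono'
    (integrableOn_Ioi_rpow_of_lt (show -(2 * γ) < -1 by linarith) one_pos)
    ((hpair.continuousOn_normSq.mono (Set.Ioi_subset_Ioi zero_le_one)).aestronglyMeasurable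
      measurableSet_Ioi) ?_
  filter_upwards [ae_restrict_mem measurableSet_Ioi] with s hs
  have hs0 : 0 < s := one_pos.trans hs
  have hmac := norm_macdonald_le hν (w := ((s ^ 3 / 9 : ℝ) : ℂ) * Complex.I)
    (by rw [Complex.re_ofReal_mul, Complex.I_re, mul_zero])
  rw [Real.norm_of_nonneg (Complex.normSq_nonneg _), Complex.normSq_eq_norm_sq,
    modelH_weylConst_eq hγ hγ' hs0, norm_mul, norm_mul, Complex.norm_real, Complex.norm_real,
    Real.norm_of_nonneg (by positivity), Real.norm_of_nonneg (by positivity)]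
  have h1 : (Real.Gamma ((2 * γ + 1) / 3))⁻¹ *
      ‖macdonald ((2 * γ + 1) / 3) (((s ^ 3 / 9 : ℝ) : ℂ) * Complex.I)‖ ≤ 1 := by
    rw [inv_mul_le_iff₀ hG, mul_one]
    exact hmac
  have e : s ^ (-(2 * γ)) = (s ^ (-γ)) ^ 2 := by
    rw [← Real.rpow_natCast, ← Real.rpow_mul hs0.le]
    congr 1
    push_cast
    ring
  rw [e]
  gcongr
  exact mul_le_of_le_one_right (by positivity) h1

/-! ### The main theorem -/

theorem mainTheorem5 (γ : ℝ) (hγ : 1 / 2 < γ) (hγ' : ∀ k : ℕ, γ ≠ ((k : ℝ) + 1) / 2) :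
    (∀ lam s : ℂ, Summable (fun n : ℕ => modelCoeff (-γ) lam n * s ^ n) ∧
      Summable (fun n : ℕ => modelCoeff (γ + 1) lam n * s ^ n)) ∧
    ∃ lam₀ : ℝ, 0 < lam₀ ∧ ∃ d : ℂ → ℂ,
      AnalyticOnNhd ℂ d (Metric.closedBall 0 lam₀) ∧
      (∀ lam : ℂ, ‖lam‖ ≤ lam₀ →
        IsModelSolution γ lam (modelH γ lam (d lam)) ∧
        IsL2AtInfinity (modelH γ lam (d lam)) ∧
        (∀ c : ℂ, IsL2AtInfinity (modelH γ lam c) → c = d lam) ∧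
        (∀ f : ℝ → ℂ, IsModelSolution γ lam f → IsL2AtInfinity f →
          ∃ a : ℂ, ∀ s : ℝ, 0 < s → f s = a * modelH γ lam (d lam) s)) ∧
      d 0 ≠ 0 ∧
      d 0 = -Complex.exp (Complex.I * ((Real.pi / 2 * ((2 * γ + 1) / 3) : ℝ) : ℂ)) *
        (((9 : ℝ) ^ (-((2 * γ + 1) / 3)) *
          (Real.Gamma (1 - (2 * γ + 1) / 3) / Real.Gamma (1 + (2 * γ + 1) / 3)) : ℝ) : ℂ) := by
  have hd0 : weylCoeff γ 0 = weylConst γ :=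
    eq_of_isL2AtInfinity_modelH hγ (lam := 0) (by simp)
      (isL2AtInfinity_weylCoeff hγ hγ' (by simp)) (isL2AtInfinity_modelH_weylConst hγ hγ')
  -- The radius 1/8 keeps the closed disc inside the open disc of radius 1/4, where `weylCoeff` is
  -- analytic.
  refine ⟨fun lam s => ⟨summable_modelCoeff _ lam s, summable_modelCoeff _ lam s⟩, 1 / 8,
    by norm_num, weylCoeff γ, (analyticOnNhd_weylCoeff hγ hγ').mono
      (Metric.closedBall_subset_ball (by norm_num)), fun lam hlam8 => ?_,
    hd0 ▸ weylConst_ne_zero hγ hγ', hd0⟩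
  have hlam : ‖lam‖ ≤ 1 / 4 := hlam8.trans (by norm_num)
  have hL2 := isL2AtInfinity_weylCoeff hγ hγ' hlam
  refine ⟨isModelSolution_iff.mpr ⟨_, isSolutionPair_modelH hγ hγ' lam _⟩, hL2,
    fun c hc => eq_of_isL2AtInfinity_modelH hγ hlam hc hL2, fun f hf hfL2 => ?_⟩
  obtain ⟨f', hpair⟩ := isModelSolution_iff.mp hf
  obtain ⟨a, b, hab⟩ := hpair.eq_frobSol_comb hγ hγ'
  -- Subtracting a H from f leaves an L² multiple of the solution with exponent γ + 1, so the factor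
  -- must vanish.
  have hdiff : IsL2AtInfinity
      (fun s => (b - a * weylCoeff γ lam) * frobSol (γ + 1) lam s) := by
    refine (MemLp.sub hfL2 (hL2.const_mul a)).ae_eq ?_
    filter_upwards [ae_restrict_mem measurableSet_Ioi] with s hs
    rw [Pi.sub_apply, hab s (one_pos.trans hs), modelH_eq]
    ring
  have hb : b - a * weylCoeff γ lam = 0 := by
    by_contra hne
    refine not_isL2AtInfinity_frobSol hγ hlam ?_
    refine (hdiff.const_mul (b - a * weylCoeff γ lam)⁻¹).ae_eq (ae_of_all _ fun s => ?_)
    field_simp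
  refine ⟨a, fun s hs => ?_⟩
  rw [hab s hs, modelH_eq]
  linear_combination frobSol (γ + 1) lam s * hb
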